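/- Let $V$ and $H$ be separable complex Hilbert spaces with $V$ continuously and densely embedded in $H$. A sesquilinear form $\mathfrak a:V\times V\to\mathbb C$ (linear in the first, antilinear in the second variable) is called bounded if there is $M$ with $|\mathfrak a(u,v)|\le M\|u\|_V\|v\|_V$ for all $u,v\in V$, and coercive if there is $\delta>0$ with $\operatorname{Re}\mathfrak a(u,u)\ge\delta\|u\|_V^2$ for all $u\in V$. For such a form let $A$ be the associated operator on $H$: $D(A)$ is the set of those $u\in V$ for which there is $f\in H$ with $\mathfrak a(u,v)=(f\,|\,v)_H$ for all $v\in V$, and $Au:=f$. Let $(e^{-tA})_{t\ge0}$ be the $C_0$-semigroup on $H$ generated by $-A$, put $$A^{-1/2}u:=\frac1{\sqrt\pi}\int_0^\infty t^{-1/2}e^{-tA}u\,dt\quad(u\in H),\qquad D(A^{1/2}):=A^{-1/2}H,$$ and say that $\mathfrak a$ has the square root property if $D(A^{1/2})=V$. For $0\le\gamma\le 1$ let $V_\gamma:=[H,V]_\gamma$ be the complex interpolation space, with norm $$\|x\|_{V_\gamma}=\inf_f\ \max\Bigl\{\sup_{t\in\mathbb R}\|f(it)\|_H,\ \sup_{t\in\mathbb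 R}\|f(1+it)\|_V\Bigr\},$$ where $f$ runs over the bounded continuous functions from $\{0\le\operatorname{Re}z\le1\}$ to $H$ that are holomorphic on $\{0<\operatorname{Re}z<1\}$, for which $t\mapsto f(1+it)$ is a bounded continuous function from $\mathbb R$ to $V$, and which satisfy $f(\gamma)=x$. Let $\mathfrak a_1,\mathfrak a_2:V\times V\to\mathbb C$ be two bounded, coercive sesquilinear forms. Assume that there are $0\le\gamma<1$ and a constant $c>0$ such that $$|\mathfrak a_1(u,v)-\mathfrak a_2(u,v)|\le c\,\|u\|_V\,\|v\|_{V_\gamma}\qquad\text{for all }u,v\in V.$$ Then $\mathfrak a_1$ has the square root property if and only if $\mathfrak a_2$ has it. -/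

import Mathlib

open scoped ComplexConjugate InnerProductSpace Topology

noncomputable section

namespace FormSqrt

section Forms

variable {V H : Type*} [NormedAddCommGroup V] [InnerProductSpace ℂ V]
  [NormedAddCommGroup H] [InnerProductSpace ℂ H]

/-- Boundedness (continuity) of a sesquilinear form, linear in the first and antilinear in the
second variable: `|a(u,v)| ≤ M ‖u‖_V ‖v‖_V`. -/
def IsBoundedForm (a : V →ₗ[ℂ] V →ₗ⋆[ℂ] ℂ) : Prop :=
  ∃ M : ℝ, ∀ u v : V, ‖a u v‖ ≤ M * ‖u‖ * ‖v‖

/-- Coercivity of a form: `Re a(u,u) ≥ δ ‖u‖_V ^ 2` for some `δ > 0`. -/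
def IsCoerciveForm (a : V →ₗ[ℂ] V →ₗ⋆[ℂ] ℂ) : Prop :=
  ∃ δ : ℝ, 0 < δ ∧ ∀ u : V, δ * ‖u‖ ^ 2 ≤ (a u u).re

/-- The graph of the part in `H` of the operator `V → V'` induced by `a`, where `V` is embedded in
`H` by `j`: the pairs `(j u, f)` with `a(u,v) = (f | j v)_H` for all `v ∈ V`. The scalar product
of `H` in the usual notation `(f | g)`, linear in `f`, is `⟪g, f⟫_ℂ` in Mathlib. -/
def operatorGraph (j : V →L[ℂ] H) (a : V →ₗ[ℂ] V →ₗ⋆[ℂ] ℂ) : Submodule ℂ (H × H) where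
  carrier := {p | ∃ u : V, j u = p.1 ∧ ∀ v : V, a u v = ⟪j v, p.2⟫_ℂ}
  zero_mem' := ⟨0, by simp, by simp⟩
  add_mem' := by
    rintro p q ⟨u, hu, hu'⟩ ⟨w, hw, hw'⟩
    exact ⟨u + w, by simp [hu, hw], fun v => by simp [hu', hw']⟩
  smul_mem' := by
    rintro c p ⟨u, hu, hu'⟩
    exact ⟨c • u, by simp [hu], fun v => by simp [hu']⟩

/-- The (unbounded) operator `A` on `H` associated with the form `a`. -/
def formOperator (j : V →L[ℂ] H) (a : V →ₗ[ℂ] V →ₗ⋆[ℂ] ℂ) : H →ₗ.[ℂ] H :=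
  (operatorGraph j a).toLinearPMap

/-- For an injective embedding with dense range, `operatorGraph` is the graph of an operator. -/
theorem formOperator_graph (j : V →L[ℂ] H) (hj : Function.Injective j) (hd : DenseRange j)
    (a : V →ₗ[ℂ] V →ₗ⋆[ℂ] ℂ) : (formOperator j a).graph = operatorGraph j a := by
  refine Submodule.toLinearPMap_graph_eq _ ?_
  rintro ⟨x, f⟩ ⟨u, hu, hf⟩ hx
  simp only at hu hx hf
  have hu0 : u = 0 := hj (by rw [hu, hx, map_zero])
  subst hu0
  refine hd.eq_zero_of_inner_right ℂ ?_
  intro v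
  simpa using (hf v).symm

end Forms

section Semigroups

variable {H : Type*} [NormedAddCommGroup H] [InnerProductSpace ℂ H]

/-- `S` (only its values at `t ≥ 0` matter) is a `C₀`-semigroup of bounded operators on `H` whose
infinitesimal generator is the operator `B`. -/
structure IsC0SemigroupGeneratedBy (S : ℝ → H →L[ℂ] H) (B : H →ₗ.[ℂ] H) : Prop where
  map_zero : S 0 = ContinuousLinearMap.id ℂ H
  map_add : ∀ s t : ℝ, 0 ≤ s → 0 ≤ t → S (s + t) = (S s).comp (S t)
  continuousOn : ∀ x : H, ContinuousOn (fun t => S t x) (Set.Ici 0)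
  generator : ∀ x y : H,
    (x, y) ∈ B.graph ↔ Filter.Tendsto (fun t : ℝ => t⁻¹ • (S t x - x)) (𝓝[>] 0) (𝓝 y)

/-- `A^{-1/2} u = π^{-1/2} ∫_0^∞ t^{-1/2} e^{-tA} u dt`, where `S t = e^{-tA}`. -/
def invSqrt (S : ℝ → H →L[ℂ] H) (u : H) : H :=
  (1 / √Real.pi) • ∫ t in Set.Ioi (0 : ℝ), t ^ (-(1 / 2) : ℝ) • S t u

/-- `D(A^{1/2}) = A^{-1/2} H`, with `A^{-1/2}` built from the semigroup `S t = e^{-tA}` generated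
by `-A` (a generator determines its semigroup). -/
def sqrtDomain (A : H →ₗ.[ℂ] H) : Set H :=
  {x | ∃ S : ℝ → H →L[ℂ] H, IsC0SemigroupGeneratedBy S (-A) ∧ ∃ u : H, invSqrt S u = x}

end Semigroups

section SquareRoot

variable {V H : Type*} [NormedAddCommGroup V] [InnerProductSpace ℂ V]
  [NormedAddCommGroup H] [InnerProductSpace ℂ H]

/-- The square root property `D(A^{1/2}) = V`, as subsets of `H`. -/
def SquareRootProperty (j : V →L[ℂ] H) (a : V →ₗ[ℂ] V →ₗ⋆[ℂ] ℂ) : Prop :=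
  sqrtDomain (formOperator j a) = Set.range j

/-- Membership in the Calderón space of the couple `(H, V)`, with norm at most `M`. As `V` is
continuously embedded in `H` by `j`, the sum space `H + V` is `H` with an equivalent norm. Thus
`f` is bounded and continuous on the closed strip `0 ≤ Re z ≤ 1` and holomorphic in its interior,
with values in `H`; on the line `Re z = 0` it is bounded by `M` in `H`; on the line `Re z = 1` it
is a continuous `V`-valued function bounded by `M` in `V`. -/
def IsCalderonFunction (j : V →L[ℂ] H) (f : ℂ → H) (M : ℝ) : Prop :=
  DiffContOnCl ℂ f (Complex.HadamardThreeLines.verticalStrip 0 1) ∧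
  (∃ K : ℝ, ∀ z ∈ Complex.HadamardThreeLines.verticalClosedStrip 0 1, ‖f z‖ ≤ K) ∧
  (∀ t : ℝ, ‖f (t * Complex.I)‖ ≤ M) ∧
  ∃ g : ℝ → V, Continuous g ∧ ∀ t : ℝ, j (g t) = f (1 + t * Complex.I) ∧ ‖g t‖ ≤ M

/-- The norm of the complex interpolation space `V_γ = [H, V]_γ`: the infimum of the Calderón norms
of the functions `f` with `f γ = x`. -/
def interpNorm (j : V →L[ℂ] H) (γ : ℝ) (x : H) : ℝ :=
  sInf {M : ℝ | ∃ f : ℂ → H, IsCalderonFunction j f M ∧ f γ = x}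

/-- The elements of `V` lie in `V_γ`: the infimum defining their norm is over a nonempty set, which
is bounded below by `0`. -/
theorem interpNorm_set_nonempty (j : V →L[ℂ] H) (γ : ℝ) (v : V) :
    {M : ℝ | ∃ f : ℂ → H, IsCalderonFunction j f M ∧ f γ = j v}.Nonempty ∧
      0 ∈ lowerBounds {M : ℝ | ∃ f : ℂ → H, IsCalderonFunction j f M ∧ f γ = j v} := by
  refine ⟨⟨max ‖j v‖ ‖v‖, fun _ => j v, ⟨diffContOnCl_const, ⟨‖j v‖, fun _ _ => le_rfl⟩,
    fun _ => le_max_left _ _, fun _ => v, continuous_const, fun _ => ⟨rfl, le_max_right _ _⟩⟩,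
    rfl⟩, ?_⟩
  rintro M ⟨f, hf, -⟩
  exact (norm_nonneg _).trans (hf.2.2.1 0)

end SquareRoot

end FormSqrt

end

set_option linter.unusedSectionVars false

noncomputable section

/-! Put `T = A^{-1/2}`. Exchanging the order of integration turns the semigroup formula into `T =
π⁻¹ ∫ l^{-1/2} (l + A)⁻¹ dl` over `l > 0`. Coercivity bounds `(l + A)⁻¹ f` by a multiple of
`l^{-1/2}` in `V` and of `l⁻¹` in `H`, so the integral converges in `H`, but its convergence in `V`
at infinity just fails to follow, by a logarithm.

The perturbation hypothesis gains what is missing. Testing the equation for the difference `w` of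
the two resolvents with `w` itself, and using `‖v‖_{V_γ} ≤ ‖v‖_H^{1-γ} ‖v‖_V^γ` (`interpNorm_le`),
shows that `w` is `O(l^{-(1-γ/2)})` in `V` (`CoerciveWith.norm_res_sub_res_le`). Since `γ < 1`, the
integral of the difference converges in `V`, hence `T₁ - T₂` maps `H` into `V`
(`formInvSqrt_sub_mem_range`). Thus `T₁ H ⊆ V` implies `T₂ H ⊆ V`.

The inclusion `V ⊆ T₂ H` comes by duality. From `T² = A⁻¹` one gets that `T H = V` forces `T* H ⊆ V`
(`CoerciveWith.adjoint_mem_range`), and that `T* H ⊆ V` forces `V ⊆ T H`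
(`CoerciveWith.range_subset`). Between these two implications, `T₁*` is replaced by `T₂*` by the
same decay for the adjoint resolvents. That decay needs its own proof
(`CoerciveWith.norm_res_adjoint_sub_res_adjoint_le`), as the hypothesis is not symmetric in `u` and
`v`.

The rest links this with the definition through semigroups: Hille–Yosida supplies a semigroup
generated by `-A`, every such semigroup has `(l + A)⁻¹` as Laplace transform, and a Gaussian
polar-coordinate computation gives `T² = A⁻¹`. -/

namespace FormSqrt

/-! ### Lax–Milgram resolvents of a coercive form and their decay in `H` and `V`. -/

section Resolvent

variable {V H : Type*} [NormedAddCommGroup V] [InnerProductSpace ℂ V] [CompleteSpace V]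
  [NormedAddCommGroup H] [InnerProductSpace ℂ H] [CompleteSpace H]

/-- Coercivity, with constant `δ`, of the form `(u, v) ↦ ⟪v, B u⟫` represented by the bounded
operator `B`. -/
structure CoerciveWith (B : V →L[ℂ] V) (δ : ℝ) : Prop where
  pos : 0 < δ
  le_re : ∀ u : V, δ * ‖u‖ ^ 2 ≤ (⟪u, B u⟫_ℂ).re

theorem CoerciveWith.adjoint {B : V →L[ℂ] V} {δ : ℝ} (h : CoerciveWith B δ) :
    CoerciveWith (ContinuousLinearMap.adjoint B) δ := by
  refine ⟨h.pos, fun u => ?_⟩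
  rw [ContinuousLinearMap.adjoint_inner_right, ← inner_conj_symm, Complex.conj_re]
  exact h.le_re u

/-- The operator representing the form `⟪v, B u⟫ + l * ⟪j v, j u⟫`. -/
def shifted (j : V →L[ℂ] H) (B : V →L[ℂ] V) (l : ℝ) : V →L[ℂ] V :=
  B + (l : ℂ) • (ContinuousLinearMap.adjoint j ∘L j)

theorem inner_shifted (j : V →L[ℂ] H) (B : V →L[ℂ] V) (l : ℝ) (u v : V) :
    ⟪v, shifted j B l u⟫_ℂ = ⟪v, B u⟫_ℂ + l * ⟪j v, j u⟫_ℂ := by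
  simp [shifted, ContinuousLinearMap.adjoint_inner_right]

theorem CoerciveWith.shifted {j : V →L[ℂ] H} {B : V →L[ℂ] V} {δ : ℝ} (h : CoerciveWith B δ)
    {l : ℝ} (hl : 0 ≤ l) : CoerciveWith (shifted j B l) δ := by
  refine ⟨h.pos, fun u => ?_⟩
  rw [inner_shifted, inner_self_eq_norm_sq_to_K]
  have := h.le_re u
  have h2 : ((l : ℂ) * ((‖j u‖ : ℂ)) ^ 2).re = l * ‖j u‖ ^ 2 := by norm_cast
  simp only [Complex.add_re, Complex.coe_algebraMap, h2]
  nlinarith [mul_nonneg hl (sq_nonneg ‖j u‖)]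

theorem CoerciveWith.isUnit {B : V →L[ℂ] V} {δ : ℝ} (h : CoerciveWith B δ) : IsUnit B := by
  refine ContinuousLinearMap.isUnit_of_forall_le_norm_inner_map B (c := ⟨δ, h.pos.le⟩) h.pos
    fun x => ?_
  rw [← inner_conj_symm, RCLike.norm_conj]
  calc ‖x‖ ^ 2 * δ = δ * ‖x‖ ^ 2 := mul_comm _ _
    _ ≤ (⟪x, B x⟫_ℂ).re := h.le_re x
    _ ≤ ‖⟪x, B x⟫_ℂ‖ := Complex.re_le_norm _

/-- The resolvent `(l + A)⁻¹`, as a map from `H` to `V`, of the operator `A` associated with the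
form represented by `B`. -/
def res (j : V →L[ℂ] H) (B : V →L[ℂ] V) (l : ℝ) : H →L[ℂ] V :=
  Ring.inverse (shifted j B l) ∘L ContinuousLinearMap.adjoint j

variable {j : V →L[ℂ] H} {B : V →L[ℂ] V} {δ : ℝ}

theorem CoerciveWith.inner_res (h : CoerciveWith B δ) {l : ℝ} (hl : 0 ≤ l) (f : H) (v : V) :
    ⟪v, B (res j B l f)⟫_ℂ + l * ⟪j v, j (res j B l f)⟫_ℂ = ⟪j v, f⟫_ℂ := by
  have h1 := Ring.mul_inverse_cancel _ (h.shifted (j := j) hl).isUnit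
  have h2 : FormSqrt.shifted j B l (res j B l f) = ContinuousLinearMap.adjoint j f := by
    have := congrArg (fun T : V →L[ℂ] V => T (ContinuousLinearMap.adjoint j f)) h1
    simpa [res] using this
  rw [← inner_shifted, h2, ContinuousLinearMap.adjoint_inner_right]

theorem CoerciveWith.eq_of_forall_inner (h : CoerciveWith B δ) {l : ℝ} (hl : 0 ≤ l) {u w : V}
    (hu : ∀ v, ⟪v, B u⟫_ℂ + l * ⟪j v, j u⟫_ℂ = ⟪v, B w⟫_ℂ + l * ⟪j v, j w⟫_ℂ) : u = w := by
  have h1 : ⟪u - w, FormSqrt.shifted j B l (u - w)⟫_ℂ = 0 := by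
    rw [map_sub, inner_sub_right, inner_shifted, inner_shifted, hu, sub_self]
  have h2 := (h.shifted (j := j) hl).le_re (u - w)
  rw [h1, Complex.zero_re] at h2
  have h3 : ‖u - w‖ ^ 2 ≤ 0 := nonpos_of_mul_nonpos_right h2 h.pos
  exact sub_eq_zero.1 (norm_eq_zero.1 (pow_eq_zero_iff two_ne_zero |>.1 (le_antisymm h3
    (sq_nonneg _))))

theorem CoerciveWith.eq_res (h : CoerciveWith B δ) {l : ℝ} (hl : 0 ≤ l) {u : V} {f : H}
    (hu : ∀ v, ⟪v, B u⟫_ℂ + l * ⟪j v, j u⟫_ℂ = ⟪j v, f⟫_ℂ) : u = res j B l f :=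
  h.eq_of_forall_inner hl fun v => by rw [hu, h.inner_res hl]

theorem CoerciveWith.res_sub_res (h : CoerciveWith B δ) {l m : ℝ} (hl : 0 ≤ l) (hm : 0 ≤ m)
    (f : H) : res j B l f - res j B m f = (m - l) • res j B l (j (res j B m f)) := by
  have h1 : res j B m f = res j B l (f - (m - l) • j (res j B m f)) := by
    refine h.eq_res hl fun v => ?_
    rw [inner_sub_right, ← h.inner_res hm f v, ← Complex.coe_smul, inner_smul_right]
    push_cast
    ring
  calc res j B l f - res j B m f
      = res j B l f - res j B l (f - (m - l) • j (res j B m f)) := by rw [← h1]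
    _ = (m - l) • res j B l (j (res j B m f)) := by
      rw [map_sub, sub_sub_cancel, ← Complex.coe_smul, map_smul, Complex.coe_smul]

theorem CoerciveWith.inner_res_adjoint (h : CoerciveWith B δ) {l : ℝ} (hl : 0 ≤ l) (f g : H) :
    ⟪j (res j B l f), g⟫_ℂ = ⟪f, j (res j (ContinuousLinearMap.adjoint B) l g)⟫_ℂ := by
  rw [← h.adjoint.inner_res hl g, ← inner_conj_symm f, ← h.inner_res hl f,
    ContinuousLinearMap.adjoint_inner_right]
  simp [inner_conj_symm]

/-- Take real parts. Keeping both terms on the left lets one inequality control the `V`-norm and,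
with weight `l`, the `H`-norm. -/
theorem CoerciveWith.energy_le (h : CoerciveWith B δ) {l : ℝ} {u : V} {z : ℂ}
    (hu : ⟪u, B u⟫_ℂ + l * ⟪j u, j u⟫_ℂ = z) : δ * ‖u‖ ^ 2 + l * ‖j u‖ ^ 2 ≤ ‖z‖ := by
  have h2 : ((l : ℂ) * ((‖j u‖ : ℂ)) ^ 2).re = l * ‖j u‖ ^ 2 := by norm_cast
  have h3 := congrArg Complex.re hu
  rw [inner_self_eq_norm_sq_to_K (j u)] at h3
  simp only [Complex.add_re, Complex.coe_algebraMap, h2] at h3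
  have := h.le_re u
  have := Complex.re_le_norm z
  linarith

theorem CoerciveWith.res_energy_le (h : CoerciveWith B δ) {l : ℝ} (hl : 0 ≤ l) (f : H) :
    δ * ‖res j B l f‖ ^ 2 + l * ‖j (res j B l f)‖ ^ 2 ≤ ‖f‖ * ‖j (res j B l f)‖ :=
  (h.energy_le (h.inner_res hl f _)).trans ((norm_inner_le_norm _ _).trans (mul_comm _ _).le)

theorem CoerciveWith.mul_norm_res_le (h : CoerciveWith B δ) {l : ℝ} (hl : 0 ≤ l) (f : H) :
    l * ‖j (res j B l f)‖ ≤ ‖f‖ := by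
  have h1 := h.res_energy_le (j := j) hl f
  have h2 : 0 ≤ δ * ‖res j B l f‖ ^ 2 := mul_nonneg h.pos.le (sq_nonneg _)
  rcases (norm_nonneg (j (res j B l f))).eq_or_lt with h0 | h0
  · rw [← h0, mul_zero]; exact norm_nonneg _
  · refine le_of_mul_le_mul_right ?_ h0
    nlinarith

theorem CoerciveWith.norm_res_le (h : CoerciveWith B δ) {l : ℝ} (hl : 0 ≤ l) (f : H) :
    ‖res j B l f‖ ≤ ‖j‖ / δ * ‖f‖ := by
  have h1 := h.res_energy_le (j := j) hl f
  have h2 : 0 ≤ l * ‖j (res j B l f)‖ ^ 2 := mul_nonneg hl (sq_nonneg _)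
  have h3 := mul_le_mul_of_nonneg_left (j.le_opNorm (res j B l f)) (norm_nonneg f)
  rw [div_mul_eq_mul_div, le_div_iff₀ h.pos]
  rcases (norm_nonneg (res j B l f)).eq_or_lt with h0 | h0
  · rw [← h0, zero_mul]; positivity
  · refine le_of_mul_le_mul_right ?_ h0
    nlinarith

theorem CoerciveWith.sq_norm_res_le (h : CoerciveWith B δ) {l : ℝ} (hl : 0 < l) (f : H) :
    δ * l * ‖res j B l f‖ ^ 2 ≤ ‖f‖ ^ 2 := by
  have h1 := h.res_energy_le (j := j) hl.le f
  have h2 := h.mul_norm_res_le (j := j) hl.le f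
  have h3 := mul_le_mul_of_nonneg_left h2 (norm_nonneg f)
  have h4 : 0 ≤ l * ‖j (res j B l f)‖ ^ 2 := by positivity
  have h5 := mul_le_mul_of_nonneg_left (show δ * ‖res j B l f‖ ^ 2 ≤ ‖f‖ * ‖j (res j B l f)‖ by
    linarith) hl.le
  nlinarith

/-- This is the decay rate in `V` that interpolates against the rate `l⁻¹` in `H`; it is too weak by
itself to make `∫ l^{-1/2} (l + A)⁻¹ f dl` converge in `V`. -/
theorem CoerciveWith.norm_res_le_rpow (h : CoerciveWith B δ) {l : ℝ} (hl : 0 < l) (f : H) :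
    ‖res j B l f‖ ≤ δ ^ (-(1 / 2) : ℝ) * l ^ (-(1 / 2) : ℝ) * ‖f‖ := by
  have h1 := h.sq_norm_res_le (j := j) hl f
  have h2 := h.pos
  have h3 : √δ * √l * ‖res j B l f‖ ≤ ‖f‖ := by
    refine le_of_sq_le_sq ?_ (norm_nonneg _)
    rw [mul_pow, mul_pow, Real.sq_sqrt h2.le, Real.sq_sqrt hl.le]
    exact h1
  rw [Real.rpow_neg h2.le, Real.rpow_neg hl.le, ← Real.sqrt_eq_rpow, ← Real.sqrt_eq_rpow,
    ← mul_inv, ← div_eq_inv_mul, le_div_iff₀ (by positivity)]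
  linarith

/-- The resolvent identity and the bound uniform in `l ≥ 0` give Lipschitz continuity in `V`, which
provides measurability of the integrands later. -/
theorem CoerciveWith.continuousOn_res (h : CoerciveWith B δ) (f : H) :
    ContinuousOn (fun l => res j B l f) (Set.Ici 0) := by
  refine LipschitzOnWith.continuousOn (K := Real.toNNReal (‖j‖ / δ * (‖j‖ * (‖j‖ / δ * ‖f‖)))) ?_
  have hδ := h.pos
  refine LipschitzOnWith.of_dist_le_mul fun l hl m hm => ?_
  rw [dist_eq_norm, h.res_sub_res hl hm, norm_smul, Real.coe_toNNReal _ (by positivity), mul_comm,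
    Real.dist_eq, abs_sub_comm, Real.norm_eq_abs]
  refine mul_le_mul_of_nonneg_right ?_ (abs_nonneg _)
  refine (h.norm_res_le hl _).trans ?_
  gcongr
  exact (j.le_opNorm _).trans (by gcongr; exact h.norm_res_le hm f)

/-- A vector orthogonal to the range of `A⁻¹` is killed by `(A*)⁻¹`, hence pairs to zero with all of
`j V`. -/
theorem CoerciveWith.denseRange_res (h : CoerciveWith B δ) (hd : DenseRange j) :
    DenseRange (fun f => j (res j B 0 f)) := by
  have key : (LinearMap.range (j ∘L res j B 0).toLinearMap).topologicalClosure = ⊤ := by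
    rw [Submodule.topologicalClosure_eq_top_iff, Submodule.eq_bot_iff]
    intro g hg
    rw [Submodule.mem_orthogonal] at hg
    have h1 : j (res j (ContinuousLinearMap.adjoint B) 0 g) = 0 := by
      rw [← inner_self_eq_zero (𝕜 := ℂ), ← h.inner_res_adjoint le_rfl]
      exact hg _ ⟨_, rfl⟩
    refine hd.eq_zero_of_inner_right ℂ fun v => ?_
    have h2 := h.adjoint.res_energy_le (j := j) le_rfl g
    rw [h1, norm_zero, mul_zero, zero_mul, add_zero] at h2
    have h3 : res j (ContinuousLinearMap.adjoint B) 0 g = 0 :=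
      norm_eq_zero.1 (pow_eq_zero_iff two_ne_zero |>.1
        (le_antisymm (nonpos_of_mul_nonpos_right h2 h.pos) (sq_nonneg _)))
    have h4 := h.adjoint.inner_res (j := j) le_rfl g v
    rw [h3] at h4
    simpa using h4.symm
  have := Submodule.dense_iff_topologicalClosure_eq_top.2 key
  exact this

/-- A resolvent family of an accretive operator with bounded inverse `R 0`: `R l = (l + A)⁻¹` with
`Re ⟪x, A x⟫ ≥ ω ‖x‖ ^ 2` and dense domain. -/
structure IsAccretiveResolvent (R : ℝ → H →L[ℂ] H) (ω : ℝ) : Prop where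
  pos : 0 < ω
  sub_eq : ∀ l m : ℝ, 0 ≤ l → 0 ≤ m → ∀ x, R l x - R m x = (m - l) • R l (R m x)
  accretive : ∀ x, ω * ‖R 0 x‖ ^ 2 ≤ (⟪R 0 x, x⟫_ℂ).re
  dense : DenseRange (R 0)

theorem CoerciveWith.isAccretiveResolvent (h : CoerciveWith B δ) (hd : DenseRange j) :
    IsAccretiveResolvent (fun l => j ∘L res j B l) (δ / (‖j‖ ^ 2 + 1)) := by
  -- The `+ 1` in the constant keeps it meaningful when `j = 0`; accretivity is coercivity in `V`
  -- weakened by `‖j u‖ ≤ ‖j‖ ‖u‖`.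
  refine ⟨div_pos h.pos (by positivity), fun l m hl hm x => ?_, fun x => ?_, h.denseRange_res hd⟩
  · simp only [ContinuousLinearMap.comp_apply]
    rw [← map_sub, h.res_sub_res hl hm, ← Complex.coe_smul, ← Complex.coe_smul, map_smul]
  · simp only [ContinuousLinearMap.comp_apply]
    have h1 := h.inner_res (j := j) le_rfl x (res j B 0 x)
    rw [← h1, Complex.ofReal_zero, zero_mul, add_zero]
    refine le_trans ?_ (h.le_re _)
    have h2 := j.le_opNorm (res j B 0 x)
    rw [div_mul_eq_mul_div, div_le_iff₀ (by positivity), mul_assoc]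
    refine mul_le_mul_of_nonneg_left ?_ h.pos.le
    have := pow_le_pow_left₀ (norm_nonneg _) h2 2
    nlinarith [sq_nonneg ‖res j B 0 x‖]

end Resolvent

/-! ### Generation of a contraction semigroup by Yosida approximation. -/

section HilleYosida

open Filter Set

variable {H : Type*} [NormedAddCommGroup H] [InnerProductSpace ℂ H] [CompleteSpace H]

theorem tendsto_clm_of_dense {ι : Type*} {l : Filter ι} {T : ι → H →L[ℂ] H} {T₀ : H →L[ℂ] H}
    {K : ℝ} (hT : ∀ i x, ‖T i x‖ ≤ K * ‖x‖) {g : H → H} (hg : DenseRange g)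
    (h : ∀ f, Tendsto (fun i => T i (g f)) l (𝓝 (T₀ (g f)))) (x : H) :
    Tendsto (fun i => T i x) l (𝓝 (T₀ x)) := by
  rw [Metric.tendsto_nhds]
  intro ε hε
  set C := |K| + ‖T₀‖ + 1 with hC
  have hC0 : 0 < C := by positivity
  obtain ⟨f, hf⟩ := hg.exists_dist_lt x (show 0 < ε / 2 / C by positivity)
  filter_upwards [Metric.tendsto_nhds.1 (h f) (ε / 2) (by positivity)] with i hi
  rw [dist_eq_norm] at *
  have h1 : T i x - T₀ x = T i (x - g f) - T₀ (x - g f) + (T i (g f) - T₀ (g f)) := by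
    simp only [map_sub]; abel
  have h2 : C * ‖x - g f‖ < ε / 2 := by rwa [lt_div_iff₀' hC0] at hf
  have h3 : ‖T i (x - g f)‖ ≤ |K| * ‖x - g f‖ :=
    (hT i _).trans (by gcongr; exact le_abs_self K)
  have h4 := T₀.le_opNorm (x - g f)
  rw [h1]
  calc _ ≤ ‖T i (x - g f)‖ + ‖T₀ (x - g f)‖ + ‖T i (g f) - T₀ (g f)‖ :=
        (norm_add_le _ _).trans (by gcongr; exact norm_sub_le _ _)
    _ < ε := by nlinarith [norm_nonneg (x - g f)]

/-! ### Exponentials of dissipative bounded operators -/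

theorem hasDerivAt_apply {F : ℝ → H →L[ℂ] H} {F' : H →L[ℂ] H} {t : ℝ} (h : HasDerivAt F F' t)
    (x : H) : HasDerivAt (fun t => F t x) (F' x) t :=
  ((ContinuousLinearMap.apply ℂ H x).restrictScalars ℝ).hasFDerivAt.comp_hasDerivAt t h

theorem hasDerivAt_exp_smul_apply (P : H →L[ℂ] H) (x : H) (t : ℝ) :
    HasDerivAt (fun t : ℝ => NormedSpace.exp (t • P) x) (NormedSpace.exp (t • P) (P x)) t :=
  hasDerivAt_apply (hasDerivAt_exp_smul_const P t) x

theorem norm_exp_smul_apply_le {P : H →L[ℂ] H} (hP : ∀ x, (⟪x, P x⟫_ℂ).re ≤ 0) {t : ℝ}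
    (ht : 0 ≤ t) (x : H) : ‖NormedSpace.exp (t • P) x‖ ≤ ‖x‖ := by
  have hd : ∀ t : ℝ, HasDerivAt (fun t : ℝ => ‖NormedSpace.exp (t • P) x‖ ^ 2)
      (2 * (⟪NormedSpace.exp (t • P) x, P (NormedSpace.exp (t • P) x)⟫_ℂ).re) t := by
    intro t
    let _ : InnerProductSpace ℝ H := InnerProductSpace.rclikeToReal ℂ H
    exact (hasDerivAt_apply (hasDerivAt_exp_smul_const' P t) x).norm_sq
  have ha : Antitone fun t : ℝ => ‖NormedSpace.exp (t • P) x‖ ^ 2 :=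
    antitone_of_hasDerivAt_nonpos hd fun t => by
      have := hP (NormedSpace.exp (t • P) x)
      simp only [Pi.zero_apply]
      linarith
  have := ha ht
  simp only [zero_smul, NormedSpace.exp_zero, one_apply_eq_self] at this
  exact le_of_sq_le_sq this (norm_nonneg _)

/-- Join the two exponentials by the path `s ↦ exp(sP) exp((t-s)Q) x`; commutation makes its
derivative a product of two contractions applied to `P x - Q x`. -/
theorem norm_exp_smul_sub_exp_smul_le {P Q : H →L[ℂ] H} (hPQ : Commute P Q)
    (hP : ∀ x, (⟪x, P x⟫_ℂ).re ≤ 0) (hQ : ∀ x, (⟪x, Q x⟫_ℂ).re ≤ 0) {t : ℝ} (ht : 0 ≤ t) (x : H) :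
    ‖NormedSpace.exp (t • P) x - NormedSpace.exp (t • Q) x‖ ≤ t * ‖P x - Q x‖ := by
  have hd : ∀ s : ℝ, HasDerivAt
      (fun s : ℝ => (NormedSpace.exp (s • P) * NormedSpace.exp ((t - s) • Q)) x)
      ((NormedSpace.exp (s • P) * NormedSpace.exp ((t - s) • Q)) (P x - Q x)) s := by
    intro s
    have h1 := hasDerivAt_exp_smul_const P s
    have h2 := (hasDerivAt_exp_smul_const Q (t - s)).scomp s ((hasDerivAt_id s).const_sub t)
    refine (hasDerivAt_apply (h1.mul h2) x).congr_deriv ?_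
    have h3 : P * NormedSpace.exp ((t - s) • Q) = NormedSpace.exp ((t - s) • Q) * P :=
      ((hPQ.smul_right (t - s)).exp_right).eq
    rw [mul_assoc]
    simp only [Function.comp_apply]
    rw [h3]
    simp [sub_eq_add_neg]
  have := norm_image_sub_le_of_norm_deriv_le_segment' (a := 0) (b := t) (C := ‖P x - Q x‖)
    (fun s _ => (hd s).hasDerivWithinAt) (fun s hs => by
      rw [mul_apply_eq_comp]
      exact (norm_exp_smul_apply_le hP hs.1 _).trans
        (norm_exp_smul_apply_le hQ (sub_nonneg.2 hs.2.le) _)) t (right_mem_Icc.2 ht)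
  simpa [mul_comm] using this

/-! ### Consequences of the resolvent identity -/

namespace IsAccretiveResolvent

variable {R : ℝ → H →L[ℂ] H} {ω : ℝ}

/-- Every value of a resolvent lies in the domain, which is described here as the range of `R 0`. -/
theorem apply_eq (hR : IsAccretiveResolvent R ω) {l : ℝ} (hl : 0 ≤ l) (x : H) :
    R l x = R 0 (x - l • R l x) := by
  have h := hR.sub_eq 0 l le_rfl hl x
  rw [map_sub, ← Complex.coe_smul, map_smul, Complex.coe_smul]
  rw [sub_zero] at h
  rw [← h]
  abel

theorem apply_eq' (hR : IsAccretiveResolvent R ω) {l : ℝ} (hl : 0 ≤ l) (x : H) :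
    R 0 x - R l x = l • R l (R 0 x) := by
  have h := hR.sub_eq l 0 hl le_rfl x
  rw [zero_sub, neg_smul] at h
  rw [← neg_sub, h, neg_neg]

theorem commute (hR : IsAccretiveResolvent R ω) {l m : ℝ} (hl : 0 ≤ l) (hm : 0 ≤ m) :
    Commute (R l) (R m) := by
  rcases eq_or_ne l m with rfl | hne
  · exact Commute.refl _
  ext x
  have h1 := hR.sub_eq l m hl hm x
  have h2 := hR.sub_eq m l hm hl x
  have h3 : (m - l) • R l (R m x) = (m - l) • R m (R l x) := by
    rw [← h1, ← neg_sub, h2, ← neg_smul, neg_sub]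
  exact smul_right_injective H (sub_ne_zero.2 hne.symm) h3

theorem norm_le (hR : IsAccretiveResolvent R ω) {l : ℝ} (hl : 0 ≤ l) (x : H) :
    (l + ω) * ‖R l x‖ ≤ ‖x‖ := by
  have h1 := hR.accretive (x - l • R l x)
  rw [← hR.apply_eq hl, inner_sub_right, ← Complex.coe_smul, inner_smul_right,
    inner_self_eq_norm_sq_to_K] at h1
  have h2 : ((l : ℂ) * ((‖R l x‖ : ℂ)) ^ 2).re = l * ‖R l x‖ ^ 2 := by norm_cast
  simp only [Complex.sub_re, Complex.coe_algebraMap, h2] at h1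
  have h3 := (Complex.re_le_norm _).trans (norm_inner_le_norm (𝕜 := ℂ) (R l x) x)
  rcases (norm_nonneg (R l x)).eq_or_lt with h0 | h0
  · rw [← h0, mul_zero]; exact norm_nonneg _
  · refine le_of_mul_le_mul_right ?_ h0
    nlinarith

theorem mul_norm_le (hR : IsAccretiveResolvent R ω) {l : ℝ} (hl : 0 ≤ l) (x : H) :
    l * ‖R l x‖ ≤ ‖x‖ := by
  have := hR.norm_le hl x
  nlinarith [mul_nonneg hR.pos.le (norm_nonneg (R l x))]

theorem tendsto_smul (hR : IsAccretiveResolvent R ω) (x : H) :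
    Tendsto (fun n : ℕ => (n : ℝ) • R n x) atTop (𝓝 x) := by
  refine tendsto_clm_of_dense (T := fun n : ℕ => (n : ℝ) • R n) (T₀ := ContinuousLinearMap.id ℂ H)
    (K := 1) (fun n x => ?_) hR.dense (fun f => ?_) x
  · rw [one_mul, smul_apply, norm_smul, Real.norm_natCast]
    exact hR.mul_norm_le n.cast_nonneg x
  · have h1 : ∀ n : ℕ, ((n : ℝ) • R n) (R 0 f) = R 0 f - R n f := fun n =>
      (hR.apply_eq' n.cast_nonneg f).symm
    simp only [h1, ContinuousLinearMap.id_apply]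
    have h2 : Tendsto (fun n : ℕ => R n f) atTop (𝓝 0) := by
      refine squeeze_zero_norm' (a := fun n : ℕ => ‖f‖ / n) ?_
        (tendsto_const_nhds.div_atTop tendsto_natCast_atTop_atTop)
      filter_upwards [eventually_gt_atTop 0] with n hn
      rw [le_div_iff₀' (by exact_mod_cast hn)]
      exact hR.mul_norm_le n.cast_nonneg f
    simpa using tendsto_const_nhds.sub h2

/-- The Yosida approximations of the generator `-A`. -/
def yosida (R : ℝ → H →L[ℂ] H) (n : ℕ) : H →L[ℂ] H :=
  (n : ℝ) • ((n : ℝ) • R n - 1)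

theorem yosida_apply_range (hR : IsAccretiveResolvent R ω) (n : ℕ) (f : H) :
    yosida R n (R 0 f) = -((n : ℝ) • R n f) := by
  have h := hR.apply_eq' n.cast_nonneg f
  simp only [yosida, smul_apply, sub_apply,
    one_apply_eq_self]
  rw [← h, sub_sub_cancel_left, smul_neg]

theorem norm_yosida_apply_range_le (hR : IsAccretiveResolvent R ω) (n : ℕ) (f : H) :
    ‖yosida R n (R 0 f)‖ ≤ ‖f‖ := by
  rw [hR.yosida_apply_range, norm_neg, norm_smul, Real.norm_natCast]
  exact hR.mul_norm_le n.cast_nonneg f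

theorem yosida_dissipative (hR : IsAccretiveResolvent R ω) (n : ℕ) (x : H) :
    (⟪x, yosida R n x⟫_ℂ).re ≤ 0 := by
  have h1 := (Complex.re_le_norm _).trans (norm_inner_le_norm (𝕜 := ℂ) x (R n x))
  have h2 := mul_le_mul_of_nonneg_left (hR.mul_norm_le n.cast_nonneg x) (norm_nonneg x)
  have h3 : (⟪x, x⟫_ℂ).re = ‖x‖ ^ 2 := by
    rw [inner_self_eq_norm_sq_to_K]; norm_cast
  have hn : (0 : ℝ) ≤ n := n.cast_nonneg
  simp only [yosida, smul_apply, sub_apply,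
    one_apply_eq_self]
  rw [← Complex.coe_smul, ← Complex.coe_smul, inner_smul_right, inner_sub_right, inner_smul_right,
    Complex.re_ofReal_mul, Complex.sub_re, Complex.re_ofReal_mul, h3]
  refine mul_nonpos_of_nonneg_of_nonpos hn ?_
  nlinarith [mul_le_mul_of_nonneg_left h1 hn]

theorem yosida_commute (hR : IsAccretiveResolvent R ω) (n m : ℕ) :
    Commute (yosida R n) (yosida R m) := by
  have h := hR.commute (l := n) (m := m) n.cast_nonneg m.cast_nonneg
  unfold yosida
  exact ((((h.smul_left _).smul_right _).sub_left (Commute.one_left _)).sub_right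
    (Commute.one_right _)).smul_left _ |>.smul_right _

/-! ### The semigroup -/

/-- On the dense range of `R 0` the Yosida approximations converge, so their exponentials are Cauchy
there; contractivity extends this to all of `H`. Using `max t 0` gives contractions for every real
`t`, which avoids side conditions on `t`. -/
theorem exists_semigroup_limit (hR : IsAccretiveResolvent R ω) (t : ℝ) :
    ∃ S : H →L[ℂ] H, ∀ x,
      Tendsto (fun n => NormedSpace.exp (max t 0 • yosida R n) x) atTop (𝓝 (S x)) := by
  have ht : 0 ≤ max t 0 := le_max_right _ _
  set T : ℕ → H →L[ℂ] H := fun n => NormedSpace.exp (max t 0 • yosida R n) with hT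
  have hc : ∀ n x, ‖T n x‖ ≤ ‖x‖ := fun n x =>
    norm_exp_smul_apply_le (hR.yosida_dissipative n) ht x
  have hcau : ∀ x, CauchySeq fun n => T n x := by
    intro x
    rw [cauchySeq_iff_tendsto_dist_atTop_0]
    simp only [dist_eq_norm]
    rw [← tendsto_zero_iff_norm_tendsto_zero]
    refine tendsto_clm_of_dense (T := fun p : ℕ × ℕ => T p.1 - T p.2) (T₀ := 0) (K := 2)
      (fun p x => ?_) hR.dense (fun f => ?_) x
    · rw [sub_apply, two_mul]
      exact (norm_sub_le _ _).trans (add_le_add (hc _ _) (hc _ _))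
    · have h1 := (cauchySeq_iff_tendsto_dist_atTop_0.1 (hR.tendsto_smul f).cauchySeq).const_mul
        (max t 0)
      rw [mul_zero] at h1
      refine squeeze_zero_norm (fun p => ?_) h1
      rw [sub_apply]
      refine (norm_exp_smul_sub_exp_smul_le (hR.yosida_commute _ _) (hR.yosida_dissipative _)
        (hR.yosida_dissipative _) ht _).trans ?_
      rw [hR.yosida_apply_range, hR.yosida_apply_range, dist_eq_norm, ← norm_neg, neg_sub,
        sub_neg_eq_add, neg_add_eq_sub]
  choose g hg using fun x => cauchySeq_tendsto_of_complete (hcau x)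
  exact ⟨continuousLinearMapOfTendsto T (tendsto_pi_nhds.2 hg), hg⟩

/-- The contraction semigroup generated by `-A`; it is constant on `t ≤ 0`. -/
def semigroup (hR : IsAccretiveResolvent R ω) (t : ℝ) : H →L[ℂ] H :=
  (hR.exists_semigroup_limit t).choose

theorem tendsto_semigroup (hR : IsAccretiveResolvent R ω) (t : ℝ) (x : H) :
    Tendsto (fun n => NormedSpace.exp (max t 0 • yosida R n) x) atTop (𝓝 (hR.semigroup t x)) :=
  (hR.exists_semigroup_limit t).choose_spec x

theorem norm_semigroup_le (hR : IsAccretiveResolvent R ω) (t : ℝ) (x : H) :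
    ‖hR.semigroup t x‖ ≤ ‖x‖ :=
  le_of_tendsto (hR.tendsto_semigroup t x).norm
    (Eventually.of_forall fun n =>
      norm_exp_smul_apply_le (hR.yosida_dissipative n) (le_max_right _ _) x)

theorem semigroup_zero (hR : IsAccretiveResolvent R ω) :
    hR.semigroup 0 = ContinuousLinearMap.id ℂ H := by
  ext x
  refine tendsto_nhds_unique (hR.tendsto_semigroup 0 x) ?_
  simp

theorem tendsto_exp_yosida (hR : IsAccretiveResolvent R ω) (t : ℝ) {x : H} {u : ℕ → H}
    (hu : Tendsto u atTop (𝓝 x)) :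
    Tendsto (fun n => NormedSpace.exp (max t 0 • yosida R n) (u n)) atTop
      (𝓝 (hR.semigroup t x)) := by
  have h1 : Tendsto (fun n => NormedSpace.exp (max t 0 • yosida R n) (u n - x)) atTop (𝓝 0) := by
    refine squeeze_zero_norm (fun n => norm_exp_smul_apply_le (hR.yosida_dissipative n)
      (le_max_right _ _) _) ?_
    simpa using (hu.sub_const x).norm
  simpa [map_sub] using (hR.tendsto_semigroup t x).add h1

theorem semigroup_add (hR : IsAccretiveResolvent R ω) {s t : ℝ} (hs : 0 ≤ s) (ht : 0 ≤ t) :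
    hR.semigroup (s + t) = (hR.semigroup s).comp (hR.semigroup t) := by
  ext x
  refine tendsto_nhds_unique (hR.tendsto_semigroup (s + t) x) ?_
  have h := hR.tendsto_exp_yosida s (hR.tendsto_semigroup t x)
  refine h.congr fun n => ?_
  let _ : NormedAlgebra ℚ (H →L[ℂ] H) := NormedAlgebra.restrictScalars ℚ ℝ _
  rw [max_eq_left hs, max_eq_left ht, max_eq_left (add_nonneg hs ht), add_smul,
    NormedSpace.exp_add_of_commute (((Commute.refl _).smul_left _).smul_right _)]
  rfl

theorem continuous_semigroup (hR : IsAccretiveResolvent R ω) (x : H) :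
    Continuous fun t => hR.semigroup t x := by
  have key : ∀ f s t, ‖hR.semigroup t (R 0 f) - hR.semigroup s (R 0 f)‖
      ≤ ‖f‖ * ‖max t 0 - max s 0‖ := fun f s t =>
    le_of_tendsto ((hR.tendsto_semigroup t _).sub (hR.tendsto_semigroup s _)).norm
      (Eventually.of_forall fun n => Convex.norm_image_sub_le_of_norm_hasDerivWithin_le
        (s := Ici 0) (fun r _ => (hasDerivAt_exp_smul_apply _ _ r).hasDerivWithinAt)
        (fun r hr => (norm_exp_smul_apply_le (hR.yosida_dissipative n) hr _).trans
          (hR.norm_yosida_apply_range_le n f)) (convex_Ici 0)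
        (mem_Ici.2 (le_max_right s 0)) (mem_Ici.2 (le_max_right t 0)))
  rw [continuous_iff_continuousAt]
  intro s
  refine tendsto_clm_of_dense (K := 1) (fun t x => by rw [one_mul]; exact hR.norm_semigroup_le t x)
    hR.dense (fun f => ?_) x
  rw [tendsto_iff_norm_sub_tendsto_zero]
  refine squeeze_zero (fun _ => norm_nonneg _) (fun t => key f s t) ?_
  have : Continuous fun t : ℝ => ‖f‖ * ‖max t 0 - max s 0‖ := by fun_prop
  simpa using this.tendsto s

theorem semigroup_sub_self (hR : IsAccretiveResolvent R ω) {t : ℝ} (ht : 0 ≤ t) (f : H) :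
    hR.semigroup t (R 0 f) - R 0 f = ∫ s in (0)..t, hR.semigroup s (-f) := by
  have hcont : ∀ n, Continuous fun s : ℝ =>
      NormedSpace.exp (s • yosida R n) (yosida R n (R 0 f)) := fun n =>
    continuous_iff_continuousAt.2 fun s => (hasDerivAt_exp_smul_apply _ _ s).continuousAt
  have h1 : ∀ n, NormedSpace.exp (max t 0 • yosida R n) (R 0 f) - R 0 f =
      ∫ s in (0)..t, NormedSpace.exp (s • yosida R n) (yosida R n (R 0 f)) := by
    intro n
    rw [intervalIntegral.integral_eq_sub_of_hasDerivAt
      (fun s _ => hasDerivAt_exp_smul_apply (yosida R n) (R 0 f) s)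
      ((hcont n).intervalIntegrable _ _), max_eq_left ht]
    simp
  refine tendsto_nhds_unique ((hR.tendsto_semigroup t _).sub_const _) ?_
  simp only [h1]
  refine intervalIntegral.tendsto_integral_filter_of_dominated_convergence (fun _ => ‖f‖)
    (Eventually.of_forall fun n => (hcont n).aestronglyMeasurable)
    (Eventually.of_forall fun n => Eventually.of_forall fun s hs => ?_) (by simp)
    (Eventually.of_forall fun s hs => ?_)
  · rw [uIoc_of_le ht] at hs
    exact (norm_exp_smul_apply_le (hR.yosida_dissipative n) hs.1.le _).trans
      (hR.norm_yosida_apply_range_le n f)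
  · rw [uIoc_of_le ht] at hs
    have h2 : Tendsto (fun n => yosida R n (R 0 f)) atTop (𝓝 (-f)) := by
      simp only [hR.yosida_apply_range]
      exact (hR.tendsto_smul f).neg
    simpa [max_eq_left hs.1.le] using hR.tendsto_exp_yosida s h2

theorem tendsto_generator (hR : IsAccretiveResolvent R ω) (f : H) :
    Tendsto (fun t : ℝ => t⁻¹ • (hR.semigroup t (R 0 f) - R 0 f)) (𝓝[>] 0) (𝓝 (-f)) := by
  have hc := hR.continuous_semigroup (-f)
  have h1 : HasDerivAt (fun t => ∫ s in (0)..t, hR.semigroup s (-f)) (hR.semigroup 0 (-f)) 0 :=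
    intervalIntegral.integral_hasDerivAt_right (hc.intervalIntegrable _ _)
      (hc.stronglyMeasurableAtFilter _ _) hc.continuousAt
  have h2 := (hasDerivWithinAt_iff_tendsto_slope' self_notMem_Ioi).1
    (h1.hasDerivWithinAt (s := Ioi 0))
  rw [hR.semigroup_zero] at h2
  refine h2.congr' ?_
  filter_upwards [self_mem_nhdsWithin] with t ht
  rw [hR.semigroup_sub_self (le_of_lt ht), slope_def_module]
  simp

/-- The generator cannot be larger than `-A`: it is dissipative, whereas `1 + A` is already onto, so
a proper extension would have eigenvalue `1`. -/
theorem eq_range_of_tendsto_generator (hR : IsAccretiveResolvent R ω) {x y : H}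
    (h : Tendsto (fun t : ℝ => t⁻¹ • (hR.semigroup t x - x)) (𝓝[>] 0) (𝓝 y)) :
    x = R 0 (-y) := by
  -- If `y = -A x`, then `x - y = (1 + A) x`, so `x'` is the only candidate for `x` in the domain.
  -- The generator fixes `x - x'`, and dissipativity then forces it to vanish.
  set x' := R 1 (x - y) with hx'
  have h1 : x' = R 0 (x - y - x') := by
    simpa only [one_smul] using hR.apply_eq zero_le_one (x - y)
  have h2 := hR.tendsto_generator (x - y - x')
  rw [← h1] at h2
  have h3 : Tendsto (fun t : ℝ => t⁻¹ • (hR.semigroup t (x - x') - (x - x'))) (𝓝[>] 0)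
      (𝓝 (x - x')) := by
    convert h.sub h2 using 2
    · rw [← smul_sub, map_sub]; congr 1; abel
    · abel
  have h4 : Tendsto (fun t : ℝ => (⟪x - x', t⁻¹ • (hR.semigroup t (x - x') - (x - x'))⟫_ℂ).re)
      (𝓝[>] 0) (𝓝 (⟪x - x', x - x'⟫_ℂ).re) :=
    (Complex.continuous_re.tendsto _).comp (tendsto_const_nhds.inner h3)
  have h5 : (⟪x - x', x - x'⟫_ℂ).re = ‖x - x'‖ ^ 2 := by
    rw [inner_self_eq_norm_sq_to_K]; norm_cast
  have h6 : (⟪x - x', x - x'⟫_ℂ).re ≤ 0 := by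
    refine le_of_tendsto h4 ?_
    filter_upwards [self_mem_nhdsWithin] with t ht
    rw [← Complex.coe_smul, inner_smul_right, inner_sub_right, Complex.re_ofReal_mul,
      Complex.sub_re, h5]
    refine mul_nonpos_of_nonneg_of_nonpos (inv_nonneg.2 (le_of_lt ht)) ?_
    have h7 := (Complex.re_le_norm _).trans
      (norm_inner_le_norm (𝕜 := ℂ) (x - x') (hR.semigroup t (x - x')))
    have h8 := mul_le_mul_of_nonneg_left (hR.norm_semigroup_le t (x - x')) (norm_nonneg (x - x'))
    nlinarith
  have h9 : x - x' = 0 := by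
    rw [h5] at h6
    exact norm_eq_zero.1 (pow_eq_zero_iff two_ne_zero |>.1 (le_antisymm h6 (sq_nonneg _)))
  have h10 : x' = x := (sub_eq_zero.1 h9).symm
  rw [h10] at h1
  rwa [sub_sub_cancel_left] at h1

/-- Hille–Yosida theorem for accretive operators with bounded inverse. -/
theorem semigroup_isC0 (hR : IsAccretiveResolvent R ω) {G : H →ₗ.[ℂ] H}
    (hG : ∀ x y, (x, y) ∈ G.graph ↔ x = R 0 (-y)) :
    IsC0SemigroupGeneratedBy hR.semigroup G where
  map_zero := hR.semigroup_zero
  map_add _ _ hs ht := hR.semigroup_add hs ht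
  continuousOn x := (hR.continuous_semigroup x).continuousOn
  generator x y := by
    rw [hG]
    refine ⟨fun h => ?_, hR.eq_range_of_tendsto_generator⟩
    have := hR.tendsto_generator (-y)
    rwa [← h, neg_neg] at this

end IsAccretiveResolvent

end HilleYosida

/-! ### The inverse square root through resolvents, and its square. -/

section SquareRootOfSemigroup

open Filter Set MeasureTheory

variable {H : Type*} [NormedAddCommGroup H] [InnerProductSpace ℂ H] [CompleteSpace H]
  {R : ℝ → H →L[ℂ] H} {ω : ℝ} {S : ℝ → H →L[ℂ] H} {G : H →ₗ.[ℂ] H}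

/-! ### Semigroups generated by the negative of an accretive operator -/

namespace IsC0SemigroupGeneratedBy

theorem hasDerivWithinAt (hS : IsC0SemigroupGeneratedBy S G)
    (hG : ∀ x y, (x, y) ∈ G.graph ↔ x = R 0 (-y)) {t : ℝ} (ht : 0 ≤ t) (f : H) :
    HasDerivWithinAt (fun s => S s (R 0 f)) (S t (-f)) (Ici t) t := by
  rw [← hasDerivWithinAt_Ioi_iff_Ici, hasDerivWithinAt_iff_tendsto_slope' self_notMem_Ioi]
  have h1 := (hS.generator (R 0 f) (-f)).1 ((hG _ _).2 (by rw [neg_neg]))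
  have h2 : Tendsto (fun s : ℝ => s - t) (𝓝[>] t) (𝓝[>] 0) := by
    refine tendsto_nhdsWithin_iff.2 ⟨?_, ?_⟩
    · have : Tendsto (fun s : ℝ => s - t) (𝓝 t) (𝓝 (t - t)) :=
        (continuous_id.sub continuous_const).tendsto t
      rw [sub_self] at this
      exact this.mono_left nhdsWithin_le_nhds
    · filter_upwards [self_mem_nhdsWithin] with s hs using sub_pos.2 (mem_Ioi.1 hs)
  refine (((S t).continuous.tendsto _).comp (h1.comp h2)).congr' ?_
  filter_upwards [self_mem_nhdsWithin] with s hs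
  have hst : 0 ≤ s - t := (sub_pos.2 (mem_Ioi.1 hs)).le
  have h3 : S s (R 0 f) = S t (S (s - t) (R 0 f)) := by
    have := hS.map_add t (s - t) ht hst
    rw [add_sub_cancel] at this
    rw [this]; rfl
  rw [slope_def_module, h3, ← map_sub]
  simp only [Function.comp_apply]
  rw [← Complex.coe_smul, map_smul, Complex.coe_smul]

theorem apply_range (hS : IsC0SemigroupGeneratedBy S G)
    (hG : ∀ x y, (x, y) ∈ G.graph ↔ x = R 0 (-y)) {t : ℝ} (ht : 0 ≤ t) (f : H) :
    S t (R 0 f) = R 0 (S t f) := by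
  have h1 := (hS.generator (R 0 f) (-f)).1 ((hG _ _).2 (by rw [neg_neg]))
  have h2 := (hG (S t (R 0 f)) (S t (-f))).1 ((hS.generator _ _).2 ?_)
  · rwa [map_neg (S t), neg_neg] at h2
  refine (((S t).continuous.tendsto _).comp h1).congr' ?_
  filter_upwards [self_mem_nhdsWithin] with s hs
  have h3 : S s (S t (R 0 f)) = S t (S s (R 0 f)) := by
    have h4 := hS.map_add s t (le_of_lt hs) ht
    have h5 := hS.map_add t s ht (le_of_lt hs)
    rw [add_comm, h5] at h4
    exact (congrArg (fun T : H →L[ℂ] H => T (R 0 f)) h4).symm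
  rw [h3, ← map_sub]
  simp only [Function.comp_apply]
  rw [← Complex.coe_smul, map_smul, Complex.coe_smul]

theorem continuousOn_Icc (hS : IsC0SemigroupGeneratedBy S G) (x : H) (t : ℝ) :
    ContinuousOn (fun s => S s x) (Icc 0 t) :=
  (hS.continuousOn x).mono Icc_subset_Ici_self

/-- Here `S` is an arbitrary semigroup with this generator, so decay has to be derived from
accretivity: for `x` in the domain `e^{2ωs} ‖S s x‖²` has nonpositive right derivative, and density
does the rest. -/
theorem norm_le (hS : IsC0SemigroupGeneratedBy S G) (hR : IsAccretiveResolvent R ω)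
    (hG : ∀ x y, (x, y) ∈ G.graph ↔ x = R 0 (-y)) {t : ℝ} (ht : 0 ≤ t) (x : H) :
    ‖S t x‖ ≤ Real.exp (-ω * t) * ‖x‖ := by
  refine hR.dense.induction_on (p := fun x => ‖S t x‖ ≤ Real.exp (-ω * t) * ‖x‖) x
    (isClosed_le (by fun_prop) (by fun_prop)) fun f => ?_
  let _ : InnerProductSpace ℝ H := InnerProductSpace.rclikeToReal ℂ H
  have hd : ∀ s ∈ Ico 0 t, HasDerivWithinAt
      (fun s => Real.exp (2 * ω * s) * ‖S s (R 0 f)‖ ^ 2)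
      (Real.exp (2 * ω * s) * (2 * ω) * ‖S s (R 0 f)‖ ^ 2 +
        Real.exp (2 * ω * s) * (2 * (⟪S s (R 0 f), S s (-f)⟫_ℂ).re)) (Ici s) s := by
    intro s hs
    have h1 : HasDerivAt (fun s : ℝ => Real.exp (2 * ω * s)) (Real.exp (2 * ω * s) * (2 * ω)) s := by
      simpa using ((hasDerivAt_id s).const_mul (2 * ω)).exp
    exact h1.hasDerivWithinAt.mul (hS.hasDerivWithinAt hG hs.1 f).norm_sq
  have hle := image_le_of_deriv_right_le_deriv_boundary (a := 0) (b := t)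
    (B := fun _ => ‖R 0 f‖ ^ 2) (B' := fun _ => 0)
    ((by fun_prop : Continuous fun s : ℝ => Real.exp (2 * ω * s)).continuousOn.mul
      ((hS.continuousOn_Icc _ t).norm.pow 2)) hd (by simp [hS.map_zero]) continuousOn_const
    (fun s _ => hasDerivWithinAt_const _ _ _) (fun s hs => by
      have h2 := hR.accretive (S s f)
      rw [← hS.apply_range hG hs.1] at h2
      rw [map_neg, inner_neg_right, Complex.neg_re]
      nlinarith [Real.exp_pos (2 * ω * s)]) (right_mem_Icc.2 ht)
  refine le_of_sq_le_sq ?_ (by positivity)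
  rw [mul_pow, ← Real.exp_nat_mul]
  have h3 : Real.exp (2 * ω * t) * Real.exp (((2 : ℕ) : ℝ) * (-ω * t)) = 1 := by
    rw [← Real.exp_add, Real.exp_eq_one_iff]; push_cast; ring
  calc ‖S t (R 0 f)‖ ^ 2 = Real.exp (((2 : ℕ) : ℝ) * (-ω * t)) *
        (Real.exp (2 * ω * t) * ‖S t (R 0 f)‖ ^ 2) := by
        rw [← mul_assoc, mul_comm (Real.exp _) (Real.exp _), h3, one_mul]
    _ ≤ _ := mul_le_mul_of_nonneg_left hle (Real.exp_pos _).le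

theorem integrableOn_exp_smul (hS : IsC0SemigroupGeneratedBy S G) (hR : IsAccretiveResolvent R ω)
    (hG : ∀ x y, (x, y) ∈ G.graph ↔ x = R 0 (-y)) {l : ℝ} (hl : 0 ≤ l) (f : H) :
    IntegrableOn (fun t => Real.exp (-(l * t)) • S t f) (Ioi 0) := by
  refine Integrable.mono' ((exp_neg_integrableOn_Ioi 0 hR.pos).mul_const ‖f‖)
    (ContinuousOn.aestronglyMeasurable ?_ measurableSet_Ioi) ?_
  · exact (by fun_prop : Continuous fun t : ℝ => Real.exp (-(l * t))).continuousOn.smul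
      ((hS.continuousOn f).mono Ioi_subset_Ici_self)
  · filter_upwards [ae_restrict_mem measurableSet_Ioi] with t ht
    rw [norm_smul, Real.norm_eq_abs, Real.abs_exp]
    refine (mul_le_of_le_one_left (norm_nonneg _) ?_).trans (hS.norm_le hR hG (le_of_lt ht) f)
    rw [Real.exp_le_one_iff, neg_nonpos]
    exact mul_nonneg hl (le_of_lt ht)

/-- The resolvent is the Laplace transform of the semigroup. -/
theorem resolvent_eq_integral (hS : IsC0SemigroupGeneratedBy S G) (hR : IsAccretiveResolvent R ω)
    (hG : ∀ x y, (x, y) ∈ G.graph ↔ x = R 0 (-y)) {l : ℝ} (hl : 0 ≤ l) (f : H) :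
    R l f = ∫ t in Ioi (0 : ℝ), Real.exp (-(l * t)) • S t f := by
  have hint := hS.integrableOn_exp_smul hR hG hl f
  have hcont : ∀ x t, ContinuousOn (fun t : ℝ => Real.exp (-(l * t)) • S t x) (Icc 0 t) :=
    fun x t => (by fun_prop : Continuous fun t : ℝ => Real.exp (-(l * t))).continuousOn.smul
      (hS.continuousOn_Icc x t)
  have h1 : ∀ N : ℝ, 0 ≤ N → R l f - Real.exp (-(l * N)) • S N (R l f) =
      ∫ t in (0)..N, Real.exp (-(l * t)) • S t f := by
    intro N hN
    -- `-e^{-lt} S t (l + A)⁻¹ f` is a primitive of `e^{-lt} S t f`, because `A (l + A)⁻¹ f = f - l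
    -- (l + A)⁻¹ f`.
    have hd : ∀ t ∈ Ioo (min 0 N) (max 0 N), HasDerivWithinAt
        (fun t : ℝ => -(Real.exp (-(l * t)) • S t (R l f)))
        (Real.exp (-(l * t)) • S t f) (Ioi t) t := by
      intro t ht
      rw [min_eq_left hN] at ht
      have h2 : HasDerivAt (fun t : ℝ => Real.exp (-(l * t))) (Real.exp (-(l * t)) * (-l)) t := by
        simpa using ((hasDerivAt_id t).const_mul l).neg.exp
      have h3 := (h2.hasDerivWithinAt.smul
        (hS.hasDerivWithinAt hG ht.1.le (f - l • R l f))).neg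
      rw [← hR.apply_eq hl] at h3
      refine (hasDerivWithinAt_Ioi_iff_Ici.2 h3).congr_deriv ?_
      rw [map_neg, map_sub, ← Complex.coe_smul l, map_smul, Complex.coe_smul]
      module
    rw [intervalIntegral.integral_eq_sub_of_hasDeriv_right ?_ hd ?_]
    · simp [hS.map_zero, sub_eq_add_neg, add_comm]
    · rw [uIcc_of_le hN]
      exact (hcont _ N).neg
    · refine ContinuousOn.intervalIntegrable ?_
      rw [uIcc_of_le hN]
      exact hcont f N
  have h4 : Tendsto (fun N : ℝ => R l f - Real.exp (-(l * N)) • S N (R l f)) atTop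
      (𝓝 (∫ t in Ioi (0 : ℝ), Real.exp (-(l * t)) • S t f)) := by
    refine (intervalIntegral_tendsto_integral_Ioi 0 hint tendsto_id).congr' ?_
    filter_upwards [eventually_ge_atTop 0] with N hN using (h1 N hN).symm
  have h5 : Tendsto (fun N : ℝ => Real.exp (-(l * N)) • S N (R l f)) atTop (𝓝 0) := by
    have h6 : Tendsto (fun N : ℝ => Real.exp (-ω * N) * ‖R l f‖) atTop (𝓝 0) := by
      have : Tendsto (fun N : ℝ => Real.exp (-ω * N)) atTop (𝓝 0) :=
        Real.tendsto_exp_atBot.comp (tendsto_id.const_mul_atTop_of_neg (neg_lt_zero.2 hR.pos))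
      simpa using this.mul_const ‖R l f‖
    refine squeeze_zero_norm' ?_ h6
    filter_upwards [eventually_ge_atTop 0] with N hN
    rw [norm_smul, Real.norm_eq_abs, Real.abs_exp]
    refine (mul_le_of_le_one_left (norm_nonneg _) ?_).trans (hS.norm_le hR hG hN _)
    rw [Real.exp_le_one_iff, neg_nonpos]
    exact mul_nonneg hl hN
  refine tendsto_nhds_unique ?_ h4
  simpa using h5.const_sub (R l f)

end IsC0SemigroupGeneratedBy

/-- `A^{-1/2} f = π⁻¹ ∫_0^∞ l^{-1/2} (l + A)⁻¹ f dl`, where `R l = (l + A)⁻¹`. -/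
def resolventInvSqrt (R : ℝ → H →L[ℂ] H) (f : H) : H :=
  (1 / Real.pi) • ∫ l in Ioi (0 : ℝ), l ^ (-(1 / 2) : ℝ) • R l f

theorem integral_rpow_mul_exp {t : ℝ} (ht : 0 < t) :
    ∫ l in Ioi (0 : ℝ), l ^ (-(1 / 2) : ℝ) * Real.exp (-(l * t)) =
      √Real.pi * t ^ (-(1 / 2) : ℝ) := by
  have h := Real.integral_rpow_mul_exp_neg_mul_Ioi (a := 1 / 2) (by norm_num) ht
  rw [Real.Gamma_one_half_eq, one_div t, Real.inv_rpow ht.le, ← Real.rpow_neg ht.le, mul_comm,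
    show (1 / 2 - 1 : ℝ) = -(1 / 2) by norm_num] at h
  simp only [mul_comm _ t]
  exact h

theorem integrableOn_rpow_mul_exp {t : ℝ} (ht : 0 < t) :
    IntegrableOn (fun l : ℝ => l ^ (-(1 / 2) : ℝ) * Real.exp (-(l * t))) (Ioi 0) := by
  refine Integrable.of_integral_ne_zero ?_
  rw [integral_rpow_mul_exp ht]
  positivity

/-- Insert the Laplace transform for the resolvent, exchange the integrals and evaluate `∫ l^{-1/2}
e^{-lt} dl = √π t^{-1/2}`. As the right side does not involve `S`, uniqueness of the semigroup is
never needed. -/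
theorem IsC0SemigroupGeneratedBy.invSqrt_eq_resolventInvSqrt (hS : IsC0SemigroupGeneratedBy S G)
    (hR : IsAccretiveResolvent R ω) (hG : ∀ x y, (x, y) ∈ G.graph ↔ x = R 0 (-y)) (f : H) :
    invSqrt S f = resolventInvSqrt R f := by
  have h1 : ∫ l in Ioi (0 : ℝ), l ^ (-(1 / 2) : ℝ) • R l f =
      ∫ l in Ioi (0 : ℝ), ∫ t in Ioi (0 : ℝ),
        (l ^ (-(1 / 2) : ℝ) * Real.exp (-(l * t))) • S t f := by
    refine setIntegral_congr_fun measurableSet_Ioi fun l hl => ?_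
    simp only [hS.resolvent_eq_integral hR hG (le_of_lt hl) f, ← integral_smul, smul_smul]
  have hmeas : AEStronglyMeasurable (Function.uncurry fun l t : ℝ =>
      (l ^ (-(1 / 2) : ℝ) * Real.exp (-(l * t))) • S t f)
      ((volume.restrict (Ioi (0 : ℝ))).prod (volume.restrict (Ioi (0 : ℝ)))) := by
    rw [Measure.prod_restrict]
    refine ContinuousOn.aestronglyMeasurable ?_ (measurableSet_Ioi.prod measurableSet_Ioi)
    refine ContinuousOn.smul (f := fun p : ℝ × ℝ => p.1 ^ (-(1 / 2) : ℝ) *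
      Real.exp (-(p.1 * p.2))) (g := fun p : ℝ × ℝ => S p.2 f) (ContinuousOn.mul ?_
      (by fun_prop)) ?_
    · exact continuousOn_fst.rpow_const fun p hp => Or.inl (ne_of_gt hp.1)
    · exact (hS.continuousOn f).comp continuousOn_snd fun p hp => (mem_Ioi.1 hp.2).le
  have hnorm : ∀ l ∈ Ioi (0 : ℝ), ∀ t : ℝ,
      ‖(l ^ (-(1 / 2) : ℝ) * Real.exp (-(l * t))) • S t f‖ =
        (l ^ (-(1 / 2) : ℝ) * Real.exp (-(l * t))) * ‖S t f‖ := by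
    intro l hl t
    have : 0 ≤ l ^ (-(1 / 2) : ℝ) := Real.rpow_nonneg (le_of_lt hl) _
    rw [norm_smul, Real.norm_of_nonneg (by positivity)]
  have hint : Integrable (Function.uncurry fun l t : ℝ =>
      (l ^ (-(1 / 2) : ℝ) * Real.exp (-(l * t))) • S t f)
      ((volume.restrict (Ioi (0 : ℝ))).prod (volume.restrict (Ioi (0 : ℝ)))) := by
    rw [integrable_prod_iff' hmeas]
    constructor
    · filter_upwards [ae_restrict_mem measurableSet_Ioi] with t ht
      exact Integrable.smul_const (integrableOn_rpow_mul_exp ht) (S t f)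
    · have h2 : IntegrableOn (fun t : ℝ => √Real.pi * t ^ (-(1 / 2) : ℝ) * ‖S t f‖) (Ioi 0) := by
        -- The majorant is `√π t^{-1/2} e^{-ωt} ‖f‖`: the same integral with `t` as variable and `ω`
        -- as parameter.
        have h3 := ((integrableOn_rpow_mul_exp hR.pos).const_mul √Real.pi).mul_const ‖f‖
        refine Integrable.mono' h3 (ContinuousOn.aestronglyMeasurable ?_ measurableSet_Ioi) ?_
        · refine ContinuousOn.mul (continuousOn_const.mul ?_)
            ((hS.continuousOn f).mono Ioi_subset_Ici_self).norm
          exact continuousOn_id.rpow_const fun p hp => Or.inl (ne_of_gt hp)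
        · filter_upwards [ae_restrict_mem measurableSet_Ioi] with t ht
          have h4 : 0 ≤ t ^ (-(1 / 2) : ℝ) := Real.rpow_nonneg (le_of_lt ht) _
          rw [Real.norm_of_nonneg (by positivity), mul_assoc, mul_assoc, mul_assoc]
          have h5 := hS.norm_le hR hG (le_of_lt ht) f
          rw [neg_mul, mul_comm ω t] at h5
          gcongr
      refine h2.congr ?_
      filter_upwards [ae_restrict_mem measurableSet_Ioi] with t ht
      rw [← integral_rpow_mul_exp ht, ← integral_mul_const]
      exact setIntegral_congr_fun measurableSet_Ioi fun l hl => (hnorm l hl t).symm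
  have h6 : ∫ l in Ioi (0 : ℝ), l ^ (-(1 / 2) : ℝ) • R l f =
      √Real.pi • ∫ t in Ioi (0 : ℝ), t ^ (-(1 / 2) : ℝ) • S t f := by
    rw [h1, integral_integral_swap hint, ← integral_smul]
    refine setIntegral_congr_fun measurableSet_Ioi fun t ht => ?_
    simp only [integral_smul_const, integral_rpow_mul_exp ht, smul_smul]
  have h7 : 1 / √Real.pi = 1 / Real.pi * √Real.pi := by
    have := Real.sqrt_pos.2 Real.pi_pos
    field_simp
    exact Real.sq_sqrt Real.pi_pos.le |>.symm
  rw [invSqrt, resolventInvSqrt, h6, smul_smul, h7]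

/-! ### The square of `A^{-1/2}` -/

namespace IsC0SemigroupGeneratedBy

theorem continuous_comp (hS : IsC0SemigroupGeneratedBy S G) (f : H) {X : Type*}
    [TopologicalSpace X] {φ : X → ℝ} (hφ : Continuous φ) (h0 : ∀ x, 0 ≤ φ x) :
    Continuous fun x => S (φ x) f :=
  (hS.continuousOn f).comp_continuous hφ h0

theorem integrable_sq (hS : IsC0SemigroupGeneratedBy S G) (hR : IsAccretiveResolvent R ω)
    (hG : ∀ x y, (x, y) ∈ G.graph ↔ x = R 0 (-y)) (f : H) :
    Integrable fun x : ℝ => S (x ^ 2) f := by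
  refine Integrable.mono' ((integrable_exp_neg_mul_sq hR.pos).mul_const ‖f‖)
    (hS.continuous_comp f (by fun_prop) fun x => sq_nonneg x).aestronglyMeasurable
    (Eventually.of_forall fun x => hS.norm_le hR hG (sq_nonneg x) f)

theorem integral_Ioi_smul_sq (g : ℝ → H) :
    ∫ r in Ioi (0 : ℝ), r • g (r ^ 2) = (1 / 2 : ℝ) • ∫ t in Ioi (0 : ℝ), g t := by
  rw [← integral_comp_rpow_Ioi g two_ne_zero, ← integral_smul]
  refine setIntegral_congr_fun measurableSet_Ioi fun r _ => ?_
  have h1 : (2 : ℝ) - 1 = 1 := by norm_num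
  simp only [h1, Real.rpow_one, Real.rpow_two, smul_smul, abs_two]
  congr 1
  ring

theorem invSqrt_eq_integral_sq (hS : IsC0SemigroupGeneratedBy S G)
    (hR : IsAccretiveResolvent R ω) (hG : ∀ x y, (x, y) ∈ G.graph ↔ x = R 0 (-y)) (f : H) :
    invSqrt S f = (1 / √Real.pi) • ∫ x : ℝ, S (x ^ 2) f := by
  have hi := hS.integrable_sq hR hG f
  have h1 := integral_Ioi_smul_sq fun t : ℝ => t ^ (-(1 / 2) : ℝ) • S t f
  have h2 : ∫ r in Ioi (0 : ℝ), r • ((r ^ 2) ^ (-(1 / 2) : ℝ) • S (r ^ 2) f) =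
      ∫ r in Ioi (0 : ℝ), S (r ^ 2) f := by
    refine setIntegral_congr_fun measurableSet_Ioi fun r hr => ?_
    have hr' : (0 : ℝ) < r := hr
    rw [Real.rpow_neg (sq_nonneg r), ← Real.sqrt_eq_rpow, Real.sqrt_sq hr'.le, smul_smul,
      mul_inv_cancel₀ hr'.ne', one_smul]
  have h3 : ∫ x in Iic (0 : ℝ), S (x ^ 2) f = ∫ x in Ioi (0 : ℝ), S (x ^ 2) f := by
    have := integral_comp_neg_Iic 0 fun x : ℝ => S (x ^ 2) f
    simpa using this
  rw [invSqrt, ← intervalIntegral.integral_Iic_add_Ioi (b := 0) hi.integrableOn hi.integrableOn,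
    h3, ← h2, h1, ← add_smul]
  norm_num

/-- This is the Gaussian integral trick: after `t = x²` the square is `π⁻¹ ∬ S(x² + y²) f`, which in
polar coordinates equals `2 ∫ r S(r²) f dr = ∫ S t f dt = A⁻¹ f`. -/
theorem invSqrt_invSqrt (hS : IsC0SemigroupGeneratedBy S G) (hR : IsAccretiveResolvent R ω)
    (hG : ∀ x y, (x, y) ∈ G.graph ↔ x = R 0 (-y)) (f : H) :
    invSqrt S (invSqrt S f) = R 0 f := by
  have hi := hS.integrable_sq hR hG
  have hprod : Integrable (fun p : ℝ × ℝ => S (p.1 ^ 2 + p.2 ^ 2) f) (volume.prod volume) := by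
    refine Integrable.mono' (((integrable_exp_neg_mul_sq hR.pos).mul_prod
      (integrable_exp_neg_mul_sq hR.pos)).mul_const ‖f‖)
      (hS.continuous_comp f (by fun_prop) fun x => by positivity).aestronglyMeasurable
      (Eventually.of_forall fun p => ?_)
    refine (hS.norm_le hR hG (by positivity) f).trans_eq ?_
    rw [← Real.exp_add, mul_add]
  have h1 : ∫ x : ℝ, S (x ^ 2) (∫ y : ℝ, S (y ^ 2) f) =
      ∫ p : ℝ × ℝ, S (p.1 ^ 2 + p.2 ^ 2) f := by
    rw [show (volume : Measure (ℝ × ℝ)) = volume.prod volume from rfl, integral_prod _ hprod]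
    refine integral_congr_ae (Eventually.of_forall fun x => ?_)
    simp only
    rw [← ContinuousLinearMap.integral_comp_comm _ (hi f)]
    refine integral_congr_ae (Eventually.of_forall fun y => ?_)
    simp only [hS.map_add _ _ (sq_nonneg x) (sq_nonneg y), ContinuousLinearMap.comp_apply]
  have h2 : ∫ p : ℝ × ℝ, S (p.1 ^ 2 + p.2 ^ 2) f = Real.pi • R 0 f := by
    rw [← integral_comp_polarCoord_symm, polarCoord_target]
    have h3 : ∀ p : ℝ × ℝ, p.1 • S ((polarCoord.symm p).1 ^ 2 + (polarCoord.symm p).2 ^ 2) f =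
        p.1 • S (p.1 ^ 2) f := by
      intro p
      rw [polarCoord_symm_apply, mul_pow, mul_pow, ← mul_add, Real.cos_sq_add_sin_sq, mul_one]
    simp only [h3]
    rw [Measure.volume_eq_prod, ← Measure.prod_restrict,
      integral_fun_fst (fun r : ℝ => r • S (r ^ 2) f), integral_Ioi_smul_sq fun t => S t f,
      smul_smul, hS.resolvent_eq_integral hR hG le_rfl]
    have h4 : volume.real (Ioo (-Real.pi) Real.pi) = 2 * Real.pi := by
      simp [Measure.real, ← two_mul, ENNReal.toReal_ofReal Real.pi_pos.le]
    simp only [measureReal_restrict_apply_univ, h4, zero_mul, neg_zero, Real.exp_zero, one_smul]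
    congr 1
    ring
  rw [hS.invSqrt_eq_integral_sq hR hG f, hS.invSqrt_eq_integral_sq hR hG]
  have h4 : ∀ x : ℝ, S (x ^ 2) ((1 / √Real.pi) • ∫ y : ℝ, S (y ^ 2) f) =
      (1 / √Real.pi) • S (x ^ 2) (∫ y : ℝ, S (y ^ 2) f) := fun x => by
    rw [← Complex.coe_smul, map_smul, Complex.coe_smul]
  simp only [h4]
  rw [integral_smul, h1, h2, smul_smul, smul_smul]
  have h5 : 1 / √Real.pi * (1 / √Real.pi) * Real.pi = 1 := by
    have := Real.sqrt_pos.2 Real.pi_pos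
    field_simp
    exact (Real.sq_sqrt Real.pi_pos.le).symm
  rw [h5, one_smul]

end IsC0SemigroupGeneratedBy

end SquareRootOfSemigroup

/-! ### Upper bound for the complex interpolation norm. -/

section Interpolation

variable {V H : Type*} [NormedAddCommGroup V] [InnerProductSpace ℂ V]
  [NormedAddCommGroup H] [InnerProductSpace ℂ H]

/-- The interpolation inequality `‖v‖_{V_γ} ≤ ‖v‖_H ^ (1 - γ) * ‖v‖_V ^ γ`. -/
theorem interpNorm_le (j : V →L[ℂ] H) (hj : Function.Injective j) {γ : ℝ} (h0 : 0 ≤ γ)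
    (h1 : γ ≤ 1) (v : V) : interpNorm j γ (j v) ≤ ‖j v‖ ^ (1 - γ) * ‖v‖ ^ γ := by
  refine csInf_le ⟨0, (interpNorm_set_nonempty j γ v).2⟩ ?_
  rcases eq_or_ne v 0 with rfl | hv
  · have h2 : 0 ≤ ‖j 0‖ ^ (1 - γ) * ‖(0 : V)‖ ^ γ := by positivity
    exact ⟨fun _ => 0, ⟨diffContOnCl_const, ⟨0, by simp⟩, by simpa using h2,
      fun _ => 0, continuous_const, by simpa using h2⟩, by simp⟩
  have hv0 : 0 < ‖v‖ := norm_pos_iff.2 hv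
  have hjv : 0 < ‖j v‖ := norm_pos_iff.2 fun h => hv (hj (by rw [h, map_zero]))
  -- With this exponent `e^{(z-γ)L} v` has the same norm, `‖j v‖^{1-γ} ‖v‖^γ`, in `H` on `Re z = 0`
  -- and in `V` on `Re z = 1`.
  set L := Real.log (‖j v‖ / ‖v‖) with hL
  have hexp : ∀ x : ℝ, Real.exp (x * L) = ‖j v‖ ^ x * ‖v‖ ^ (-x) := by
    intro x
    rw [hL, mul_comm, ← Real.rpow_def_of_pos (by positivity), Real.div_rpow hjv.le hv0.le,
      Real.rpow_neg hv0.le, div_eq_mul_inv]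
  have hn : ∀ z : ℂ, ‖Complex.exp ((z - γ) * L)‖ = Real.exp ((z.re - γ) * L) := by
    intro z
    rw [Complex.norm_exp]
    simp
  refine ⟨fun z => Complex.exp ((z - γ) * L) • j v, ⟨?_, ⟨Real.exp |L| * ‖j v‖, fun z hz => ?_⟩,
    fun t => ?_, fun t => Complex.exp ((1 + t * Complex.I - γ) * L) • v, ?_, fun t => ⟨?_, ?_⟩⟩, ?_⟩
  · have : Differentiable ℂ fun z : ℂ => Complex.exp ((z - γ) * L) • j v := by fun_prop
    exact this.diffContOnCl
  · rw [norm_smul, hn]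
    obtain ⟨h2, h3⟩ : 0 ≤ z.re ∧ z.re ≤ 1 := hz
    gcongr
    refine (le_abs_self _).trans ?_
    rw [abs_mul]
    exact mul_le_of_le_one_left (abs_nonneg _) (abs_le.2 ⟨by linarith, by linarith⟩)
  · rw [norm_smul, hn, hexp]
    simp only [Complex.mul_re, Complex.ofReal_re, Complex.I_re, Complex.ofReal_im, mul_zero,
      zero_mul, sub_zero, zero_sub, neg_neg]
    rw [mul_right_comm, Real.rpow_sub hjv, Real.rpow_one, Real.rpow_neg hjv.le, div_eq_inv_mul]
  · fun_prop
  · rw [map_smul]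
  · rw [norm_smul, hn, hexp]
    simp only [Complex.add_re, Complex.one_re, Complex.mul_re, Complex.ofReal_re, Complex.I_re,
      Complex.ofReal_im, mul_zero, zero_mul, sub_zero, add_zero, neg_sub]
    rw [Real.rpow_sub hv0, Real.rpow_one, mul_assoc, div_mul_cancel₀ _ hv0.ne']
  · simp

end Interpolation

/-! ### Resolvent differences, duality and the perturbation theorem. -/

section Perturbation

open Set MeasureTheory

/-- Let `N²` be the energy on the left. Both `√δ x` and `√l y` are at most `N`, so the right side is
at most a constant times `N`, and one factor `N` cancels. -/
theorem le_of_energy_le {δ l x y K γ : ℝ} (hδ : 0 < δ) (hl : 0 < l) (hx : 0 ≤ x) (hy : 0 ≤ y)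
    (hK : 0 ≤ K) (h0 : 0 ≤ γ) (h1 : γ ≤ 1)
    (h : δ * x ^ 2 + l * y ^ 2 ≤ K * (y ^ (1 - γ) * x ^ γ)) :
    x ≤ (√δ)⁻¹ * ((√δ)⁻¹ ^ γ * K * (√l)⁻¹ ^ (1 - γ)) := by
  set N := √(δ * x ^ 2 + l * y ^ 2) with hN
  have hN2 : N ^ 2 = δ * x ^ 2 + l * y ^ 2 := Real.sq_sqrt (by positivity)
  have hN0 : 0 ≤ N := Real.sqrt_nonneg _
  have hxN : x ≤ (√δ)⁻¹ * N := by
    rw [← div_eq_inv_mul, le_div_iff₀ (Real.sqrt_pos.2 hδ)]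
    refine le_of_sq_le_sq ?_ hN0
    rw [mul_pow, Real.sq_sqrt hδ.le, hN2]
    nlinarith [mul_nonneg hl.le (sq_nonneg y)]
  have hyN : y ≤ (√l)⁻¹ * N := by
    rw [← div_eq_inv_mul, le_div_iff₀ (Real.sqrt_pos.2 hl)]
    refine le_of_sq_le_sq ?_ hN0
    rw [mul_pow, Real.sq_sqrt hl.le, hN2]
    nlinarith [mul_nonneg hδ.le (sq_nonneg x)]
  refine hxN.trans (mul_le_mul_of_nonneg_left ?_ (by positivity))
  rcases hN0.eq_or_lt with hN' | hN'
  · rw [← hN']; positivity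
  · refine le_of_mul_le_mul_right ?_ hN'
    calc N * N = N ^ 2 := (sq N).symm
      _ ≤ K * (y ^ (1 - γ) * x ^ γ) := hN2.trans_le h
      _ ≤ K * (((√l)⁻¹ * N) ^ (1 - γ) * ((√δ)⁻¹ * N) ^ γ) := by
        gcongr
      _ = (√δ)⁻¹ ^ γ * K * (√l)⁻¹ ^ (1 - γ) * (N ^ (1 - γ) * N ^ γ) := by
        rw [Real.mul_rpow (by positivity) hN0, Real.mul_rpow (by positivity) hN0]
        ring
      _ = (√δ)⁻¹ ^ γ * K * (√l)⁻¹ ^ (1 - γ) * N := by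
        rw [← Real.rpow_add hN', sub_add_cancel, Real.rpow_one]

theorem inv_sqrt_rpow {l : ℝ} (hl : 0 < l) (a : ℝ) : (√l)⁻¹ ^ a = l ^ (-(a / 2)) := by
  rw [Real.sqrt_eq_rpow, ← Real.rpow_neg hl.le, ← Real.rpow_mul hl.le]
  congr 1
  ring

theorem integrableOn_rpow_smul {E : Type*} [NormedAddCommGroup E] [NormedSpace ℝ E] {F : ℝ → E}
    (hF : ContinuousOn F (Ici 0)) {C D a : ℝ} (ha : 1 / 2 < a) (hC : ∀ l, 0 < l → ‖F l‖ ≤ C)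
    (hD : ∀ l, 0 < l → ‖F l‖ ≤ D * l ^ (-a)) :
    IntegrableOn (fun l : ℝ => l ^ (-(1 / 2) : ℝ) • F l) (Ioi 0) := by
  have hcont : ContinuousOn (fun l : ℝ => l ^ (-(1 / 2) : ℝ) • F l) (Ioi 0) :=
    (continuousOn_id.rpow_const fun p hp => Or.inl (ne_of_gt hp)).smul (hF.mono Ioi_subset_Ici_self)
  rw [← Ioc_union_Ioi_eq_Ioi (zero_le_one' ℝ)]
  refine IntegrableOn.union ?_ ?_
  · have h1 : IntegrableOn (fun l : ℝ => l ^ (-(1 / 2) : ℝ)) (Ioc 0 1) :=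
      (intervalIntegrable_iff_integrableOn_Ioc_of_le zero_le_one).1
        (intervalIntegral.intervalIntegrable_rpow' (by norm_num))
    refine Integrable.mono' (h1.mul_const C) ((hcont.mono Ioc_subset_Ioi_self).aestronglyMeasurable
      measurableSet_Ioc) ?_
    filter_upwards [ae_restrict_mem measurableSet_Ioc] with l hl
    rw [norm_smul, Real.norm_of_nonneg (Real.rpow_nonneg hl.1.le _)]
    exact mul_le_mul_of_nonneg_left (hC l hl.1) (Real.rpow_nonneg hl.1.le _)
  · have h1 : IntegrableOn (fun l : ℝ => l ^ (-(1 / 2) - a)) (Ioi 1) :=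
      integrableOn_Ioi_rpow_of_lt (by linarith) one_pos
    refine Integrable.mono' (h1.mul_const D) ((hcont.mono (Ioi_subset_Ioi
      zero_le_one)).aestronglyMeasurable measurableSet_Ioi) ?_
    filter_upwards [ae_restrict_mem measurableSet_Ioi] with l hl
    have hl0 : 0 < l := one_pos.trans hl
    rw [norm_smul, Real.norm_of_nonneg (Real.rpow_nonneg hl0.le _), sub_eq_add_neg,
      Real.rpow_add hl0, mul_assoc, mul_comm _ D]
    exact mul_le_mul_of_nonneg_left (hD l hl0) (Real.rpow_nonneg hl0.le _)

variable {V H : Type*} [NormedAddCommGroup V] [InnerProductSpace ℂ V] [CompleteSpace V]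
  [NormedAddCommGroup H] [InnerProductSpace ℂ H] [CompleteSpace H]
  {j : V →L[ℂ] H} {B B₁ B₂ : V →L[ℂ] V} {δ δ₁ δ₂ : ℝ}

theorem CoerciveWith.inner_res_sub_res (h₁ : CoerciveWith B₁ δ₁) (h₂ : CoerciveWith B₂ δ₂)
    {l : ℝ} (hl : 0 ≤ l) (f : H) (v : V) :
    ⟪v, B₂ (res j B₁ l f - res j B₂ l f)⟫_ℂ + l * ⟪j v, j (res j B₁ l f - res j B₂ l f)⟫_ℂ =
      ⟪v, B₂ (res j B₁ l f)⟫_ℂ - ⟪v, B₁ (res j B₁ l f)⟫_ℂ := by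
  have e₁ := h₁.inner_res (j := j) hl f v
  have e₂ := h₂.inner_res (j := j) hl f v
  simp only [map_sub, inner_sub_right]
  linear_combination e₁ - e₂

/-- Test the equation for the difference `w` with `w`. The factor `‖u‖_V`, with `u` the first
resolvent, contributes `l^{-1/2}`; interpolating the energy of `w` contributes `l^{-(1-γ)/2}`. -/
theorem CoerciveWith.norm_res_sub_res_le (h₁ : CoerciveWith B₁ δ₁) (h₂ : CoerciveWith B₂ δ₂)
    {γ c : ℝ} (h0 : 0 ≤ γ) (h1 : γ ≤ 1) (hc : 0 ≤ c)
    (h : ∀ u v : V, ‖⟪v, B₁ u⟫_ℂ - ⟪v, B₂ u⟫_ℂ‖ ≤ c * ‖u‖ * (‖j v‖ ^ (1 - γ) * ‖v‖ ^ γ)) (f : H) :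
    ∃ D, ∀ l, 0 < l → ‖res j B₁ l f - res j B₂ l f‖ ≤ D * l ^ (-(1 - γ / 2)) := by
  refine ⟨(√δ₂)⁻¹ * ((√δ₂)⁻¹ ^ γ * (c * (δ₁ ^ (-(1 / 2) : ℝ) * ‖f‖))), fun l hl => ?_⟩
  have h2 := h₂.energy_le (h₁.inner_res_sub_res h₂ (j := j) hl.le f _)
  rw [norm_sub_rev (⟪_, B₂ _⟫_ℂ)] at h2
  have h3 := le_of_energy_le h₂.pos hl (norm_nonneg _) (norm_nonneg _) (by positivity) h0 h1
    (h2.trans (h _ _))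
  refine h3.trans ?_
  have h4 := h₁.norm_res_le_rpow (j := j) hl f
  calc _ ≤ (√δ₂)⁻¹ * ((√δ₂)⁻¹ ^ γ * (c * (δ₁ ^ (-(1 / 2) : ℝ) * l ^ (-(1 / 2) : ℝ) * ‖f‖)) *
        (√l)⁻¹ ^ (1 - γ)) := by gcongr
    _ = (√δ₂)⁻¹ * ((√δ₂)⁻¹ ^ γ * (c * (δ₁ ^ (-(1 / 2) : ℝ) * ‖f‖))) *
        (l ^ (-(1 / 2) : ℝ) * l ^ (-((1 - γ) / 2))) := by
      rw [inv_sqrt_rpow hl (1 - γ)]; ring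
    _ = _ := by
      rw [← Real.rpow_add hl]
      congr 2
      ring

/-- Passing to adjoints swaps the arguments: the `V_γ`-norm now falls on the resolvent `u` and
contributes `l^{-(1-γ)} l^{-γ/2}`, while `‖w‖_V` cancels against coercivity. -/
theorem CoerciveWith.norm_res_adjoint_sub_res_adjoint_le (h₁ : CoerciveWith B₁ δ₁)
    (h₂ : CoerciveWith B₂ δ₂) {γ c : ℝ} (h0 : 0 ≤ γ) (h1 : γ ≤ 1) (hc : 0 ≤ c)
    (h : ∀ u v : V, ‖⟪v, B₁ u⟫_ℂ - ⟪v, B₂ u⟫_ℂ‖ ≤ c * ‖u‖ * (‖j v‖ ^ (1 - γ) * ‖v‖ ^ γ)) (f : H) :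
    ∃ D, ∀ l, 0 < l → ‖res j (ContinuousLinearMap.adjoint B₁) l f -
      res j (ContinuousLinearMap.adjoint B₂) l f‖ ≤ D * l ^ (-(1 - γ / 2)) := by
  refine ⟨c * (‖f‖ ^ (1 - γ) * (δ₁ ^ (-(1 / 2) : ℝ) * ‖f‖) ^ γ) / δ₂, fun l hl => ?_⟩
  set u := res j (ContinuousLinearMap.adjoint B₁) l f with hu
  set w := u - res j (ContinuousLinearMap.adjoint B₂) l f with hw
  have h2 := h₂.adjoint.energy_le (h₁.adjoint.inner_res_sub_res h₂.adjoint (j := j) hl.le f w)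
  rw [ContinuousLinearMap.adjoint_inner_right, ContinuousLinearMap.adjoint_inner_right,
    ← inner_conj_symm, ← inner_conj_symm (B₁ w), ← map_sub, RCLike.norm_conj,
    norm_sub_rev (⟪_, B₂ _⟫_ℂ)] at h2
  have h3 := h2.trans (h w u)
  have hδ₂ := h₂.pos
  have hδ₁ := h₁.pos
  have h4 : δ₂ * ‖w‖ ≤ c * (‖j u‖ ^ (1 - γ) * ‖u‖ ^ γ) := by
    rcases (norm_nonneg w).eq_or_lt with hw0 | hw0
    · rw [← hw0, mul_zero]; positivity
    · refine le_of_mul_le_mul_right ?_ hw0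
      nlinarith [mul_nonneg hl.le (sq_nonneg ‖j w‖)]
  have h5 : ‖j u‖ ≤ l⁻¹ * ‖f‖ := by
    rw [← div_eq_inv_mul, le_div_iff₀' hl]
    exact h₁.adjoint.mul_norm_res_le hl.le f
  have h6 := h₁.adjoint.norm_res_le_rpow (j := j) hl f
  rw [div_mul_eq_mul_div, le_div_iff₀' hδ₂]
  refine h4.trans ?_
  calc c * (‖j u‖ ^ (1 - γ) * ‖u‖ ^ γ)
      ≤ c * ((l⁻¹ * ‖f‖) ^ (1 - γ) *
        (δ₁ ^ (-(1 / 2) : ℝ) * l ^ (-(1 / 2) : ℝ) * ‖f‖) ^ γ) := by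
        gcongr
    _ = c * (‖f‖ ^ (1 - γ) * (δ₁ ^ (-(1 / 2) : ℝ) * ‖f‖) ^ γ) *
        (l⁻¹ ^ (1 - γ) * (l ^ (-(1 / 2) : ℝ)) ^ γ) := by
      rw [mul_right_comm (δ₁ ^ (-(1 / 2) : ℝ)), Real.mul_rpow (by positivity) (by positivity),
        Real.mul_rpow (x := δ₁ ^ (-(1 / 2) : ℝ) * ‖f‖) (by positivity) (by positivity)]
      ring
    _ = _ := by
      rw [← Real.rpow_neg_one l, ← Real.rpow_mul hl.le, ← Real.rpow_mul hl.le, ← Real.rpow_add hl]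
      congr 2
      ring

/-! ### Inverse square roots of operators associated with forms -/

/-- The operator `A^{-1/2}` for the operator `A` associated with the form represented by `B`. -/
def formInvSqrt (j : V →L[ℂ] H) (B : V →L[ℂ] V) : H → H :=
  resolventInvSqrt fun l => j ∘L res j B l

theorem CoerciveWith.integrableOn_resolvent (h : CoerciveWith B δ) (f : H) :
    IntegrableOn (fun l : ℝ => l ^ (-(1 / 2) : ℝ) • j (res j B l f)) (Ioi 0) := by
  refine integrableOn_rpow_smul (j.continuous.comp_continuousOn (h.continuousOn_res f)) (a := 1)
    (C := ‖j‖ * (‖j‖ / δ * ‖f‖)) (D := ‖f‖) (by norm_num) (fun l hl => ?_) fun l hl => ?_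
  · exact (j.le_opNorm _).trans (mul_le_mul_of_nonneg_left (h.norm_res_le hl.le f) (norm_nonneg _))
  · rw [Real.rpow_neg_one, ← div_eq_mul_inv, le_div_iff₀' hl]
    exact h.mul_norm_res_le hl.le f

theorem CoerciveWith.inner_formInvSqrt (h : CoerciveWith B δ) (f g : H) :
    ⟪formInvSqrt j B f, g⟫_ℂ = ⟪f, formInvSqrt j (ContinuousLinearMap.adjoint B) g⟫_ℂ := by
  simp only [formInvSqrt, resolventInvSqrt, ContinuousLinearMap.comp_apply]
  rw [← Complex.coe_smul, ← Complex.coe_smul, inner_smul_left, inner_smul_right,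
    Complex.conj_ofReal, ← inner_conj_symm, ← integral_inner (h.integrableOn_resolvent f),
    ← integral_inner (h.adjoint.integrableOn_resolvent g), ← integral_conj]
  congr 1
  refine setIntegral_congr_fun measurableSet_Ioi fun l hl => ?_
  rw [inner_conj_symm, ← Complex.coe_smul, ← Complex.coe_smul, inner_smul_left, inner_smul_right,
    Complex.conj_ofReal, h.inner_res_adjoint (le_of_lt hl)]

/-- The integral of the difference converges in `V`: boundedness handles `l` near `0`, and decay
with `a > 1/2` handles infinity. The embedding `j` commutes with the integral. -/
theorem formInvSqrt_sub_mem_range (h₁ : CoerciveWith B₁ δ₁) (h₂ : CoerciveWith B₂ δ₂) {a : ℝ}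
    (ha : 1 / 2 < a) {f : H}
    (h : ∃ D, ∀ l, 0 < l → ‖res j B₁ l f - res j B₂ l f‖ ≤ D * l ^ (-a)) :
    formInvSqrt j B₁ f - formInvSqrt j B₂ f ∈ LinearMap.range j.toLinearMap := by
  obtain ⟨D, hD⟩ := h
  have hint := integrableOn_rpow_smul (F := fun l => res j B₁ l f - res j B₂ l f)
    ((h₁.continuousOn_res (j := j) f).sub (h₂.continuousOn_res f))
    (C := ‖j‖ / δ₁ * ‖f‖ + ‖j‖ / δ₂ * ‖f‖) ha (fun l hl => (norm_sub_le _ _).trans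
      (add_le_add (h₁.norm_res_le hl.le f) (h₂.norm_res_le hl.le f))) hD
  refine ⟨(1 / Real.pi) • ∫ l in Ioi (0 : ℝ), l ^ (-(1 / 2) : ℝ) • (res j B₁ l f - res j B₂ l f), ?_⟩
  simp only [formInvSqrt, resolventInvSqrt, ContinuousLinearMap.comp_apply,
    ContinuousLinearMap.coe_coe]
  rw [← smul_sub, ← integral_sub (h₁.integrableOn_resolvent f) (h₂.integrableOn_resolvent f),
    ← Complex.coe_smul, map_smul, Complex.coe_smul, ← ContinuousLinearMap.integral_comp_comm _ hint]
  congr 1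
  refine setIntegral_congr_fun measurableSet_Ioi fun l _ => ?_
  rw [← smul_sub, ← map_sub, ← Complex.coe_smul, map_smul, Complex.coe_smul]

/-- An everywhere defined operator with a formal adjoint and with range in `V` is bounded from `H`
to `V`. -/
theorem exists_clm_lift (hj : Function.Injective j) {T T' : H → H}
    (hT : ∀ f g, ⟪T f, g⟫_ℂ = ⟪f, T' g⟫_ℂ) (hr : ∀ f, T f ∈ LinearMap.range j.toLinearMap) :
    ∃ Q : H →L[ℂ] V, ∀ f, j (Q f) = T f := by
  choose q hq using hr
  have hq' : ∀ f, j (q f) = T f := hq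
  let Q : H →ₗ[ℂ] V :=
    { toFun := q
      -- Linearity, like closedness of the graph below, comes from the formal adjoint, so `T` need
      -- not be bundled as a linear map.
      map_add' := fun f g => hj (ext_inner_right ℂ fun x => by
        rw [map_add, inner_add_left, hq', hq', hq', hT, hT, hT, inner_add_left])
      map_smul' := fun c f => hj (ext_inner_right ℂ fun x => by
        rw [RingHom.id_apply, map_smul, inner_smul_left, hq', hq', hT, hT, inner_smul_left]) }
  refine ⟨⟨Q, Q.continuous_of_seq_closed_graph fun u x y hu hQu => ?_⟩, hq'⟩
  refine hj (ext_inner_right ℂ fun g => ?_)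
  have h1 : Filter.Tendsto (fun n => ⟪j (Q (u n)), g⟫_ℂ) Filter.atTop (𝓝 ⟪j y, g⟫_ℂ) :=
    ((j.continuous.tendsto y).comp hQu).inner tendsto_const_nhds
  have h2 : Filter.Tendsto (fun n => ⟪u n, T' g⟫_ℂ) Filter.atTop (𝓝 ⟪x, T' g⟫_ℂ) :=
    hu.inner tendsto_const_nhds
  have h3 : ∀ n, ⟪j (Q (u n)), g⟫_ℂ = ⟪u n, T' g⟫_ℂ := fun n => by
    rw [← hT, ← hq' (u n)]; rfl
  simp only [h3] at h1
  rw [tendsto_nhds_unique h1 h2, ← hT, ← hq' x]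
  rfl

theorem CoerciveWith.eq_zero_of_res_eq_zero (h : CoerciveWith B δ) (hd : DenseRange j) {f : H}
    (hf : res j B 0 f = 0) : f = 0 := by
  refine hd.eq_zero_of_inner_right ℂ fun v => ?_
  rw [← h.inner_res le_rfl f v, hf]
  simp

/-- If `A^{-1/2} H = V`, then `(A^*)^{-1/2} H ⊆ V`. -/
theorem CoerciveWith.adjoint_mem_range (h : CoerciveWith B δ) (hj : Function.Injective j)
    (hd : DenseRange j)
    (hsq : ∀ f, formInvSqrt j B (formInvSqrt j B f) = j (res j B 0 f))
    (hr : range (formInvSqrt j B) = range j) (g : H) :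
    formInvSqrt j (ContinuousLinearMap.adjoint B) g ∈ LinearMap.range j.toLinearMap := by
  obtain ⟨Q, hQ⟩ := exists_clm_lift hj (h.inner_formInvSqrt (j := j))
    (fun f => (hr ▸ mem_range_self f : formInvSqrt j B f ∈ range j))
  have hQQ : ∀ f, Q (formInvSqrt j B f) = res j B 0 f := fun f => hj (by rw [hQ, hsq])
  have hker : LinearMap.ker Q.toLinearMap = ⊥ := by
    refine LinearMap.ker_eq_bot'.2 fun f hf => h.eq_zero_of_res_eq_zero hd ?_
    have hf' : Q f = 0 := hf
    rw [← hQQ, ← hQ, hf', map_zero, map_zero]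
  have hran : LinearMap.range Q.toLinearMap = ⊤ := by
    refine LinearMap.range_eq_top.2 fun v => ?_
    obtain ⟨f, hf⟩ : j v ∈ range (formInvSqrt j B) := hr ▸ mem_range_self v
    exact ⟨f, hj (by rw [← hf, ← hQ]; rfl)⟩
  -- `T = j Q` with `Q` bijective from `H` to `V`, hence an isomorphism by the open mapping theorem.
  let e : H ≃L[ℂ] V := ContinuousLinearEquiv.ofBijective Q hker hran
  have he : ∀ f, e f = Q f := fun f => rfl
  obtain ⟨C, hC⟩ := h.adjoint.isUnit.exists_right_inv
  -- Solve `B* w = (Q⁻¹)* g`. As `Q T f = A⁻¹ f` in `V`, pairing gives `⟪j w, f⟫ = ⟪(Q⁻¹)* g, Q T f⟫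
  -- = ⟪g, T f⟫`, so `j w = T* g`.
  set w := C (ContinuousLinearMap.adjoint (e.symm : V →L[ℂ] H) g) with hw
  have hBw : ContinuousLinearMap.adjoint B w =
      ContinuousLinearMap.adjoint (e.symm : V →L[ℂ] H) g :=
    congrArg (fun T : V →L[ℂ] V => T (ContinuousLinearMap.adjoint (e.symm : V →L[ℂ] H) g)) hC
  refine ⟨w, ext_inner_right ℂ fun f => ?_⟩
  have h1 := h.inner_res (j := j) le_rfl f w
  rw [Complex.ofReal_zero, zero_mul, add_zero, ← ContinuousLinearMap.adjoint_inner_left, hBw,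
    ContinuousLinearMap.adjoint_inner_left, ← hQQ, ← he] at h1
  rw [ContinuousLinearMap.coe_coe, ← h1, ← inner_conj_symm _ f, ← h.inner_formInvSqrt,
    inner_conj_symm]
  simp

/-- If `(A^*)^{-1/2} H ⊆ V`, then `V ⊆ A^{-1/2} H`. -/
theorem CoerciveWith.range_subset (h : CoerciveWith B δ) (hj : Function.Injective j)
    (hsq : ∀ f, formInvSqrt j (ContinuousLinearMap.adjoint B)
      (formInvSqrt j (ContinuousLinearMap.adjoint B) f) =
        j (res j (ContinuousLinearMap.adjoint B) 0 f))
    (hr : ∀ g, formInvSqrt j (ContinuousLinearMap.adjoint B) g ∈ LinearMap.range j.toLinearMap) :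
    range j ⊆ range (formInvSqrt j B) := by
  have hadj := h.adjoint.inner_formInvSqrt (j := j)
  obtain ⟨Q, hQ⟩ := exists_clm_lift hj hadj hr
  have hQQ : ∀ g, Q (formInvSqrt j (ContinuousLinearMap.adjoint B) g) =
      res j (ContinuousLinearMap.adjoint B) 0 g := fun g => hj (by rw [hQ, hsq])
  rintro _ ⟨v, rfl⟩
  -- With `T* = j Q`, the preimage of `j v` is `Q* B v`: pairing `T Q* B v` with `g` gives `⟪B v,
  -- (A*)⁻¹ g⟫ = ⟪j v, g⟫`.
  refine ⟨ContinuousLinearMap.adjoint Q (B v), ext_inner_right ℂ fun g => ?_⟩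
  have h1 := h.adjoint.inner_res (j := j) le_rfl g v
  rw [Complex.ofReal_zero, zero_mul, add_zero, ContinuousLinearMap.adjoint_inner_right] at h1
  rw [h.inner_formInvSqrt, ContinuousLinearMap.adjoint_inner_left, hQQ, h1]

/-! ### Forms -/

theorem exists_clm_of_isBoundedForm {a : V →ₗ[ℂ] V →ₗ⋆[ℂ] ℂ} (hb : IsBoundedForm a) :
    ∃ B : V →L[ℂ] V, ∀ u v, ⟪v, B u⟫_ℂ = a u v := by
  obtain ⟨M, hM⟩ := hb
  -- The conjugate form is used because the Riesz representation expects antilinearity in the first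
  -- variable.
  let b : V →L⋆[ℂ] V →L[ℂ] ℂ := LinearMap.mkContinuous₂
    (LinearMap.mk₂'ₛₗ (starRingEnd ℂ) (RingHom.id ℂ) (fun u v => conj (a u v)) (by simp) (by simp)
      (by simp) (by simp)) M (fun u v => by simpa using hM u v)
  refine ⟨InnerProductSpace.continuousLinearMapOfBilin b, fun u v => ?_⟩
  rw [← inner_conj_symm, InnerProductSpace.continuousLinearMapOfBilin_apply]
  simp [b]

theorem mem_graph_neg_formOperator {a : V →ₗ[ℂ] V →ₗ⋆[ℂ] ℂ} (hj : Function.Injective j)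
    (hd : DenseRange j) (h : CoerciveWith B δ) (hB : ∀ u v, ⟪v, B u⟫_ℂ = a u v) (x y : H) :
    (x, y) ∈ (-formOperator j a).graph ↔ x = (j ∘L res j B 0) (-y) := by
  have key : ∀ x f, (x, f) ∈ operatorGraph j a ↔ x = j (res j B 0 f) := by
    intro x f
    constructor
    · rintro ⟨u, hu, hf⟩
      have : u = res j B 0 f := h.eq_res le_rfl fun v => by
        rw [hB, hf, Complex.ofReal_zero, zero_mul, add_zero]
      rw [← this]
      exact hu.symm
    · rintro rfl
      refine ⟨_, rfl, fun v => ?_⟩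
      have := h.inner_res (j := j) le_rfl f v
      rw [Complex.ofReal_zero, zero_mul, add_zero, hB] at this
      exact this
  rw [LinearPMap.neg_graph, formOperator_graph j hj hd, ContinuousLinearMap.comp_apply, ← key]
  constructor
  · rintro ⟨⟨x', f⟩, hp, he⟩
    simp only [LinearMap.prodMap_apply, Prod.mk.injEq, LinearMap.id_apply, LinearMap.neg_apply]
      at he
    rw [← he.1, ← he.2, neg_neg]
    exact hp
  · intro hp
    exact ⟨(x, -y), hp, by simp⟩

/-- One inclusion holds for every semigroup generated by `-A`; the other needs one to exist, which
is where Hille–Yosida enters. -/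
theorem sqrtDomain_formOperator {a : V →ₗ[ℂ] V →ₗ⋆[ℂ] ℂ} (hj : Function.Injective j)
    (hd : DenseRange j) (h : CoerciveWith B δ) (hB : ∀ u v, ⟪v, B u⟫_ℂ = a u v) :
    sqrtDomain (formOperator j a) = range (formInvSqrt j B) := by
  have hR := h.isAccretiveResolvent hd
  have hG := mem_graph_neg_formOperator hj hd h hB
  ext x
  constructor
  · rintro ⟨S, hS, u, rfl⟩
    exact ⟨u, (hS.invSqrt_eq_resolventInvSqrt hR hG u).symm⟩
  · rintro ⟨u, rfl⟩
    have hS := hR.semigroup_isC0 hG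
    exact ⟨hR.semigroup, hS, u, hS.invSqrt_eq_resolventInvSqrt hR hG u⟩

theorem CoerciveWith.formInvSqrt_formInvSqrt (h : CoerciveWith B δ) (hj : Function.Injective j)
    (hd : DenseRange j) (f : H) :
    formInvSqrt j B (formInvSqrt j B f) = j (res j B 0 f) := by
  have hR := h.isAccretiveResolvent hd
  let a : V →ₗ[ℂ] V →ₗ⋆[ℂ] ℂ := LinearMap.mk₂'ₛₗ (RingHom.id ℂ) (starRingEnd ℂ)
    (fun u v => ⟪v, B u⟫_ℂ) (by simp) (by simp) (by simp)
    (by simp [mul_comm])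
  have hG := mem_graph_neg_formOperator (a := a) hj hd h fun u v => rfl
  have hS := hR.semigroup_isC0 hG
  have := hS.invSqrt_invSqrt hR hG f
  rwa [hS.invSqrt_eq_resolventInvSqrt hR hG, hS.invSqrt_eq_resolventInvSqrt hR hG] at this

/-- The square root property is stable under perturbations of lower order. -/
theorem CoerciveWith.range_formInvSqrt_of_perturbation (h₁ : CoerciveWith B₁ δ₁)
    (h₂ : CoerciveWith B₂ δ₂) (hj : Function.Injective j) (hd : DenseRange j) {γ c : ℝ}
    (h0 : 0 ≤ γ) (h1 : γ < 1) (hc : 0 ≤ c)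
    (h : ∀ u v : V, ‖⟪v, B₁ u⟫_ℂ - ⟪v, B₂ u⟫_ℂ‖ ≤ c * ‖u‖ * (‖j v‖ ^ (1 - γ) * ‖v‖ ^ γ))
    (hr : range (formInvSqrt j B₁) = range j) : range (formInvSqrt j B₂) = range j := by
  -- Exactly here `γ < 1` is used: it makes `l^{-1/2} l^{-(1-γ/2)}` integrable at infinity.
  have ha : 1 / 2 < 1 - γ / 2 := by linarith
  refine Subset.antisymm ?_ (h₂.range_subset hj (h₂.adjoint.formInvSqrt_formInvSqrt hj hd)
    fun g => ?_)
  · rintro _ ⟨f, rfl⟩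
    have hm : formInvSqrt j B₁ f ∈ LinearMap.range j.toLinearMap :=
      (hr ▸ mem_range_self f : formInvSqrt j B₁ f ∈ range j)
    have := sub_mem hm (formInvSqrt_sub_mem_range h₁ h₂ ha
      (h₁.norm_res_sub_res_le h₂ h0 h1.le hc h f))
    rw [sub_sub_cancel] at this
    exact this
  · have := sub_mem (h₁.adjoint_mem_range hj hd (h₁.formInvSqrt_formInvSqrt hj hd) hr g)
      (formInvSqrt_sub_mem_range h₁.adjoint h₂.adjoint ha
        (h₁.norm_res_adjoint_sub_res_adjoint_le h₂ h0 h1.le hc h g))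
    rwa [sub_sub_cancel] at this

theorem SquareRootProperty.of_perturbation {a₁ a₂ : V →ₗ[ℂ] V →ₗ⋆[ℂ] ℂ}
    (hj : Function.Injective j) (hd : DenseRange j)
    (hb₁ : IsBoundedForm a₁) (hc₁ : IsCoerciveForm a₁)
    (hb₂ : IsBoundedForm a₂) (hc₂ : IsCoerciveForm a₂)
    {γ c : ℝ} (h0 : 0 ≤ γ) (h1 : γ < 1) (hc : 0 ≤ c)
    (hpert : ∀ u v : V, ‖a₁ u v - a₂ u v‖ ≤ c * ‖u‖ * interpNorm j γ (j v))
    (h : SquareRootProperty j a₁) : SquareRootProperty j a₂ := by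
  obtain ⟨B₁, hB₁⟩ := exists_clm_of_isBoundedForm hb₁
  obtain ⟨B₂, hB₂⟩ := exists_clm_of_isBoundedForm hb₂
  obtain ⟨δ₁, hδ₁, hc₁⟩ := hc₁
  obtain ⟨δ₂, hδ₂, hc₂⟩ := hc₂
  have h₁ : CoerciveWith B₁ δ₁ := ⟨hδ₁, fun u => by rw [hB₁]; exact hc₁ u⟩
  have h₂ : CoerciveWith B₂ δ₂ := ⟨hδ₂, fun u => by rw [hB₂]; exact hc₂ u⟩
  rw [SquareRootProperty, sqrtDomain_formOperator hj hd h₁ hB₁] at h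
  rw [SquareRootProperty, sqrtDomain_formOperator hj hd h₂ hB₂]
  refine h₁.range_formInvSqrt_of_perturbation h₂ hj hd h0 h1 hc (fun u v => ?_) h
  rw [hB₁, hB₂]
  exact (hpert u v).trans (mul_le_mul_of_nonneg_left (interpNorm_le j hj h0 h1.le v)
    (by positivity))

end Perturbation

end FormSqrt

end

/-- Here `j` is the dense continuous embedding of `V` in `H`. -/
theorem proposition2p4 {V H : Type*}
    [NormedAddCommGroup V] [InnerProductSpace ℂ V] [CompleteSpace V]
    [TopologicalSpace.SeparableSpace V]
    [NormedAddCommGroup H] [InnerProductSpace ℂ H] [CompleteSpace H]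
    [TopologicalSpace.SeparableSpace H]
    (j : V →L[ℂ] H) (hj_inj : Function.Injective j) (hj_dense : DenseRange j)
    (a₁ a₂ : V →ₗ[ℂ] V →ₗ⋆[ℂ] ℂ)
    (hb₁ : FormSqrt.IsBoundedForm a₁) (hc₁ : FormSqrt.IsCoerciveForm a₁)
    (hb₂ : FormSqrt.IsBoundedForm a₂) (hc₂ : FormSqrt.IsCoerciveForm a₂)
    (γ : ℝ) (hγ₀ : 0 ≤ γ) (hγ₁ : γ < 1)
    (c : ℝ) (hc : 0 < c)
    (hpert : ∀ u v : V, ‖a₁ u v - a₂ u v‖ ≤ c * ‖u‖ * FormSqrt.interpNorm j γ (j v)) :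
    FormSqrt.SquareRootProperty j a₁ ↔ FormSqrt.SquareRootProperty j a₂ :=
  ⟨.of_perturbation hj_inj hj_dense hb₁ hc₁ hb₂ hc₂ hγ₀ hγ₁ hc.le hpert,
    .of_perturbation hj_inj hj_dense hb₂ hc₂ hb₁ hc₁ hγ₀ hγ₁ hc.le fun u v => by
      rw [norm_sub_rev]; exact hpert u v⟩
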